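/- Let $A\subset A'$ be an unramified extension of discrete valuation rings, i.e. a generator $x$ of the maximal ideal of $A$ also generates the maximal ideal of $A'$. Suppose that the induced extensions of fraction fields $\mathrm{Fr}(A)\subset \mathrm{Fr}(A')$ and of residue fields $A/xA\to A'/xA'$ are separable (not necessarily algebraic; a field extension $K/k$ is separable if every finitely generated subextension $L/k$ is separably generated, i.e. $L$ is separable algebraic over $k(s)$ for some transcendence basis $s$ of $L/k$). Then every sub-$A$-algebra $B\subset A'$ of finite type is contained in a sub-$A$-algebra $C\subset A'$ of finite type such that the localization $C_{xA'\cap C}$ is a regular local ring. -/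

import Mathlib

/-- A (not necessarily algebraic) field extension `K / k` is *separable* if every finitely generated
subextension `L / k` is separably generated: `L` has a transcendence basis `s` over `k` such that
`L` is a separable algebraic extension of `k(s)`. -/
def IsSeparableFieldExtension (k K : Type*) [Field k] [Field K] [Algebra k K] : Prop :=
  ∀ L : IntermediateField k K, L.FG →
    ∃ s : Set L, IsTranscendenceBasis k ((↑) : s → L) ∧
      Algebra.IsSeparable (IntermediateField.adjoin k s) L

/-! This is Néron's desingularization by dilatations. Let `x` be a uniformizer of `A`, hence of
`A'`, and let a finite family `b` generate `B`. Let `N` be the `A'`-span of the gradients at `b` of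
all polynomials over `A` vanishing at `b`. Then `A'^ι / N` is the module of differentials of `A[b]`
over `A`, base changed to `A'`. Its torsion has finite length, and the proof is an induction on that
length.

If `N` is spanned by gradients of relations `f j` that stay independent in the residue field, a
Jacobian criterion (`isRegularLocalRing_of_linearIndependent_evalGrad`) shows that `A[b]` is already
regular at the center of `A'`. Separability of the fraction fields ensures that the `f j` give all
relations there.

Otherwise some relation `f₀` has gradient `x • r₀` with `r₀ ∉ N` (`exists_gradRelations_dichotomy`).
Let `P` be the ideal of polynomials whose value at `b` is a nonunit. Separability of the residue
fields puts `f₀` locally in `P ^ 2`. After adjoining `p j (b) / x`, where the `p j` and `x` generate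
`P` locally, a multiple of `f₀ / x ^ 2` becomes a relation; it contributes `r₀`, and the torsion
length drops (`exists_dilatation_length_lt`).

Both uses of separability rest on `exists_mul_mem_ker_sq_of_aeval_pderiv_eq_zero`: finitely
generated separable extensions are formally smooth, so a polynomial vanishing with its gradient at a
point lies locally in the square of the ideal of that point. -/

/-! ### Regular local rings: quotients by part of a parameter system, and integrality. -/

-- `hind` expresses independence of the `f i` in the cotangent space. Completing them to generators
-- of the maximal ideal lowers the embedding dimension by `c`, while the Krull dimension drops by at
-- most `c`.
open IsLocalRing in
theorem IsRegularLocalRing.quotient_span_range {R : Type*} [CommRing R] [IsRegularLocalRing R]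
    {c : ℕ} (f : Fin c → R) (hf : ∀ i, f i ∈ maximalIdeal R)
    (hind : ∀ a : Fin c → R, ∑ i, a i * f i ∈ maximalIdeal R ^ 2 → ∀ i, a i ∈ maximalIdeal R) :
    ∃ _ : IsRegularLocalRing (R ⧸ Ideal.span (Set.range f)),
      (maximalIdeal (R ⧸ Ideal.span (Set.range f))).spanFinrank + c
        ≤ (maximalIdeal R).spanFinrank := by
  classical
  set J := Ideal.span (Set.range f) with hJ
  have hJm : J ≤ maximalIdeal R := Ideal.span_le.2 (by rintro _ ⟨i, rfl⟩; exact hf i)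
  have hJtop : J ≠ ⊤ := fun h => (maximalIdeal.isMaximal R).ne_top (top_le_iff.1 (h ▸ hJm))
  have : Nontrivial (R ⧸ J) := Ideal.Quotient.nontrivial_iff.2 hJtop
  have : IsLocalRing (R ⧸ J) :=
    IsLocalRing.of_surjective' (Ideal.Quotient.mk J) Ideal.Quotient.mk_surjective
  let u : Fin c → CotangentSpace R := fun i => (maximalIdeal R).toCotangent ⟨f i, hf i⟩
  have hu : LinearIndependent (ResidueField R) u := by
    rw [Fintype.linearIndependent_iff]
    intro g hg i
    choose a ha using fun i => residue_surjective (R := R) (g i)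
    rw [← ha i, residue_eq_zero_iff]
    refine hind a ?_ i
    have h1 : (maximalIdeal R).toCotangent (∑ i, a i • ⟨f i, hf i⟩) = 0 := by
      rw [map_sum, ← hg]
      refine Finset.sum_congr rfl fun i _ => ?_
      rw [map_smul, ← ha i]
      rfl
    rw [Ideal.toCotangent_eq_zero] at h1
    simpa using h1
  set W := Submodule.span (ResidueField R) (Set.range u) with hW
  have hWr : Module.finrank (ResidueField R) W = c := by
    rw [hW, finrank_span_eq_card hu, Fintype.card_fin]
  have hrank := W.finrank_quotient_add_finrank
  set n := Module.finrank (ResidueField R) (CotangentSpace R ⧸ W) with hn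
  let b : Module.Basis (Fin n) (ResidueField R) (CotangentSpace R ⧸ W) :=
    Module.finBasis _ _
  have hlift : ∀ j, ∃ g : maximalIdeal R, W.mkQ ((maximalIdeal R).toCotangent g) = b j := by
    intro j
    obtain ⟨y, hy⟩ := W.mkQ_surjective (b j)
    obtain ⟨z, hz⟩ := (maximalIdeal R).toCotangent_surjective y
    exact ⟨z, by rw [hz, hy]⟩
  choose g hg using hlift
  -- By Nakayama it suffices to generate modulo the square of the maximal ideal, where the basis `b`
  -- and the span `W` supply the coefficients.
  have key : maximalIdeal R ≤ J ⊔ Ideal.span (Set.range fun j => (g j : R)) := by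
    refine Submodule.le_of_le_smul_of_le_jacobson_bot (I := maximalIdeal R)
      (IsNoetherian.noetherian _) (maximalIdeal_le_jacobson _) ?_
    intro z hz
    let z' : maximalIdeal R := ⟨z, hz⟩
    choose a ha using fun j =>
      residue_surjective (R := R) (b.repr (W.mkQ ((maximalIdeal R).toCotangent z')) j)
    have h1 : (maximalIdeal R).toCotangent (z' - ∑ j, a j • g j) ∈ W := by
      rw [← W.ker_mkQ, LinearMap.mem_ker, map_sub, map_sub, sub_eq_zero]
      conv_lhs => rw [← b.sum_repr (W.mkQ ((maximalIdeal R).toCotangent z'))]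
      rw [map_sum, map_sum]
      refine Finset.sum_congr rfl fun j _ => ?_
      rw [← ha j, ← hg j, map_smul]
      rfl
    obtain ⟨e, he⟩ := (Submodule.mem_span_range_iff_exists_fun _).1 h1
    choose e' he' using fun i => residue_surjective (R := R) (e i)
    have h2 : (maximalIdeal R).toCotangent
        ((z' - ∑ j, a j • g j) - ∑ i, e' i • ⟨f i, hf i⟩) = 0 := by
      rw [map_sub, ← he, sub_eq_zero, map_sum]
      refine Finset.sum_congr rfl fun i _ => ?_
      rw [map_smul, ← he' i]
      rfl
    rw [Ideal.toCotangent_eq_zero] at h2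
    have h3 : z = (∑ i, e' i * f i + ∑ j, a j * g j) +
        (z - ∑ j, a j * (g j : R) - ∑ i, e' i * f i) := by ring
    rw [h3]
    refine Submodule.add_mem_sup (Submodule.add_mem_sup ?_ ?_) ?_
    · exact Submodule.sum_mem _ fun i _ => Ideal.mul_mem_left _ _ (Ideal.subset_span ⟨i, rfl⟩)
    · exact Submodule.sum_mem _ fun i _ => Ideal.mul_mem_left _ _ (Ideal.subset_span ⟨i, rfl⟩)
    · rw [smul_eq_mul, ← sq]
      simpa [z'] using h2
  have hmax : maximalIdeal (R ⧸ J) =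
      Ideal.span (Set.range fun j => Ideal.Quotient.mk J (g j : R)) := by
    apply le_antisymm
    · intro z hz
      obtain ⟨z, rfl⟩ := Ideal.Quotient.mk_surjective z
      have hz' : z ∈ maximalIdeal R := by
        rw [mem_maximalIdeal, mem_nonunits_iff] at hz ⊢
        exact fun h => hz (h.map _)
      have h4 := Ideal.mem_map_of_mem (Ideal.Quotient.mk J) (key hz')
      rw [Ideal.map_sup, Ideal.map_quotient_self, bot_sup_eq, Ideal.map_span, ← Set.range_comp] at h4
      exact h4
    · rw [Ideal.span_le]
      rintro _ ⟨j, rfl⟩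
      rw [SetLike.mem_coe, mem_maximalIdeal, mem_nonunits_iff]
      intro h
      obtain ⟨y, hy⟩ := h.exists_right_inv
      obtain ⟨y, rfl⟩ := Ideal.Quotient.mk_surjective y
      rw [← map_mul, ← map_one (Ideal.Quotient.mk J), Ideal.Quotient.mk_eq_mk_iff_sub_mem] at hy
      refine (Ideal.ne_top_iff_one _).1 (maximalIdeal.isMaximal R).ne_top ?_
      have := sub_mem (Ideal.mul_mem_right y _ (g j).2) (hJm hy)
      rwa [sub_sub_cancel] at this
  have hle : (maximalIdeal (R ⧸ J)).spanFinrank ≤ n := by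
    rw [hmax]
    refine (Submodule.spanFinrank_span_le_ncard_of_finite (Set.finite_range _)).trans ?_
    rw [← Set.image_univ]
    exact (Set.ncard_image_le Set.finite_univ).trans (by simp [Set.ncard_univ])
  have hd : n + c = (maximalIdeal R).spanFinrank := by
    rw [spanFinrank_maximalIdeal_eq_finrank_cotangentSpace, ← hrank, hWr]
  have hreg := (isRegularLocalRing_iff R).1 ‹_›
  have hdim : ringKrullDim R ≤ ringKrullDim (R ⧸ J) + c := by
    have hs : ((Finset.univ.image f : Finset R) : Set R) = Set.range f := by simp
    have h5 := ringKrullDim_le_ringKrullDim_quotient_add_card (Finset.univ.image f) (by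
      rw [IsLocalRing.ringJacobson_eq_maximalIdeal, hs]
      rintro _ ⟨i, rfl⟩
      exact hf i)
    rw [hs] at h5
    refine h5.trans (add_le_add le_rfl ?_)
    exact_mod_cast Finset.card_image_le.trans (by simp)
  refine ⟨IsRegularLocalRing.of_spanFinrank_maximalIdeal_le _ ?_, by omega⟩
  rw [← hreg, ← hd] at hdim
  have : ((n : ℕ) : WithBot ℕ∞) ≤ ringKrullDim (R ⧸ J) := by
    obtain ⟨k, hk⟩ := ENat.ne_top_iff_exists.1
      (Ideal.height_ne_top (maximalIdeal.isMaximal (R ⧸ J)).ne_top)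
    rw [← maximalIdeal_height_eq_ringKrullDim, ← hk] at hdim ⊢
    have h5 : n + c ≤ k + c := by exact_mod_cast hdim
    have h6 : n ≤ k := by omega
    exact_mod_cast h6
  refine le_trans ?_ this
  exact_mod_cast hle

-- For `x` in the maximal ideal, outside its square and outside all minimal primes, `R/(x)` is
-- regular of smaller embedding dimension, so `(x)` is prime by induction. A minimal prime `p ≤ (x)`
-- then satisfies `p = x p`, and vanishes by Nakayama.
open IsLocalRing in
theorem IsRegularLocalRing.isDomain (R : Type*) [CommRing R] [IsRegularLocalRing R] :
    IsDomain R := by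
  induction hn : (maximalIdeal R).spanFinrank using Nat.strong_induction_on generalizing R with
  | _ n ih =>
  by_cases hm : maximalIdeal R = ⊥
  · exact (isField_iff_maximalIdeal_eq.2 hm).isDomain
  have hsq : ¬ maximalIdeal R ≤ maximalIdeal R ^ 2 := fun h => hm <|
    Submodule.eq_bot_of_le_smul_of_le_jacobson_bot (maximalIdeal R) _ (IsNoetherian.noetherian _)
      (by rwa [smul_eq_mul, ← sq]) (maximalIdeal_le_jacobson _)
  have hmin : maximalIdeal R ∉ minimalPrimes R := by
    intro h
    have h0 : ringKrullDim R = 0 := by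
      rw [← maximalIdeal_height_eq_ringKrullDim, Ideal.height_eq_zero_iff.2 h]
      rfl
    rw [← (isRegularLocalRing_iff R).1 ‹_›] at h0
    have h1 : (maximalIdeal R).spanFinrank = 0 := by exact_mod_cast h0
    exact hm ((Submodule.spanFinrank_eq_zero_iff_eq_bot (IsNoetherian.noetherian _)).1 h1)
  obtain ⟨x, hx, hx2, hxp⟩ : ∃ x ∈ maximalIdeal R, x ∉ maximalIdeal R ^ 2 ∧
      ∀ p ∈ minimalPrimes R, x ∉ p := by
    by_contra! hcon
    have hfin : (insert (maximalIdeal R ^ 2) (minimalPrimes R)).Finite :=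
      (minimalPrimes.finite_of_isNoetherianRing R).insert _
    -- Prime avoidance tolerates two ideals that are not prime; both slots go to `maximalIdeal R ^
    -- 2`.
    have h := (Ideal.subset_union_prime_finite hfin (f := id) (maximalIdeal R ^ 2)
      (maximalIdeal R ^ 2) (by
        rintro p hp hne -
        exact (hp.resolve_left hne).1.1) (I := maximalIdeal R)).1 (by
        intro x hx
        by_cases h2 : x ∈ maximalIdeal R ^ 2
        · exact Set.mem_biUnion (Set.mem_insert _ _) h2
        · obtain ⟨p, hp, hxp⟩ := hcon x hx h2
          exact Set.mem_biUnion (Set.mem_insert_of_mem _ hp) hxp)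
    obtain ⟨p, hp | hp, hle⟩ := h
    · exact hsq (hp ▸ hle)
    · have := hp.1.1
      exact hmin ((le_maximalIdeal this.ne_top).antisymm hle ▸ hp)
  obtain ⟨hreg, hlt⟩ := IsRegularLocalRing.quotient_span_range (fun _ : Fin 1 => x)
    (fun _ => hx) (by
      intro a ha i
      by_contra hai
      have hu : IsUnit (a i) := by
        by_contra h
        exact hai ((mem_maximalIdeal _).2 h)
      rw [Fin.sum_univ_one, Subsingleton.elim 0 i] at ha
      exact hx2 (((maximalIdeal R ^ 2).unit_mul_mem_iff_mem hu).1 ha))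
  have hdom := ih _ (by omega) (R ⧸ Ideal.span (Set.range fun _ : Fin 1 => x)) rfl
  rw [Set.range_const] at hdom
  have hprime : (Ideal.span {x}).IsPrime := (Ideal.Quotient.isDomain_iff_prime _).1 hdom
  obtain ⟨p, hp, hle⟩ := Ideal.exists_minimalPrimes_le (bot_le : ⊥ ≤ Ideal.span {x})
  have hpp := hp.1.1
  have hbot : p = ⊥ := by
    refine Submodule.eq_bot_of_le_smul_of_le_jacobson_bot (maximalIdeal R) _
      (IsNoetherian.noetherian _) ?_ (maximalIdeal_le_jacobson _)
    intro y hy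
    obtain ⟨z, rfl⟩ := Ideal.mem_span_singleton'.1 (hle hy)
    rw [mul_comm, ← smul_eq_mul]
    exact Submodule.smul_mem_smul hx ((hpp.mem_or_mem hy).resolve_right (hxp p hp))
  rw [hbot] at hpp
  exact IsDomain.of_bot_isPrime R

/-! ### Taylor expansion, formal smoothness and separable field extensions. -/

-- First-order Taylor formula: `h` kills every second-order term in the difference of the two
-- points.
open MvPolynomial in
theorem MvPolynomial.algHom_eq_add_sum_pderiv {k E ι : Type*} [CommRing k] [CommRing E]
    [Algebra k E] [Fintype ι] (α β : MvPolynomial ι k →ₐ[k] E)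
    (h : ∀ i j, (α (X i) - β (X i)) * (α (X j) - β (X j)) = 0) (f : MvPolynomial ι k) :
    α f = β f + ∑ i, β (pderiv i f) * (α (X i) - β (X i)) := by
  classical
  induction f using MvPolynomial.induction_on with
  | C a =>
    have h1 : α (C a) = algebraMap k E a := α.commutes a
    have h2 : β (C a) = algebraMap k E a := β.commutes a
    simp [h1, h2]
  | add p q hp hq =>
    simp only [map_add, add_mul, Finset.sum_add_distrib, hp, hq]
    ring
  | mul_X p n hp =>
    have h1 : ∑ i, β (pderiv i (p * X n)) * (α (X i) - β (X i)) =
        (∑ i, β (pderiv i p) * (α (X i) - β (X i))) * β (X n) +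
          β p * (α (X n) - β (X n)) := by
      have h0 : ∀ i, β (pderiv i (p * X n)) * (α (X i) - β (X i)) =
          β (pderiv i p) * (α (X i) - β (X i)) * β (X n) +
            if i = n then β p * (α (X n) - β (X n)) else 0 := by
        intro i
        rw [Derivation.leibniz, pderiv_X]
        by_cases hin : i = n
        · subst hin
          simp only [Pi.single_eq_same, smul_eq_mul, mul_one, map_add, map_mul, if_true]
          ring
        · simp only [smul_eq_mul, map_add, map_mul, if_neg hin,
            Pi.single_eq_of_ne (Ne.symm hin), mul_zero, map_zero]
          ring
      rw [Finset.sum_congr rfl fun i _ => h0 i, Finset.sum_add_distrib, ← Finset.sum_mul]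
      simp
    have h2 : (∑ i, β (pderiv i p) * (α (X i) - β (X i))) * (α (X n) - β (X n)) = 0 := by
      rw [Finset.sum_mul]
      exact Finset.sum_eq_zero fun i _ => by rw [mul_assoc, h, mul_zero]
    rw [map_mul, map_mul, h1, hp]
    linear_combination h2

open MvPolynomial in
/-- An infinitesimal form of the Jacobian criterion: sections of square-zero extensions of formally
smooth algebras allow a first order Taylor expansion. -/
theorem Algebra.FormallySmooth.aeval_eq_zero_of_pderiv {k E L ι : Type*} [CommRing k] [CommRing E]
    [CommRing L] [Algebra k E] [Algebra k L] [Finite ι] [Algebra.FormallySmooth k L]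
    (g : E →ₐ[k] L) (hg : Function.Surjective g) (hker : ∀ y z, g y = 0 → g z = 0 → y * z = 0)
    (y : ι → E) (f : MvPolynomial ι k) (hf : g (aeval y f) = 0)
    (hd : ∀ i, g (aeval y (pderiv i f)) = 0) : aeval y f = 0 := by
  cases nonempty_fintype ι
  have hnil : IsNilpotent (RingHom.ker (g : E →+* L)) := by
    refine ⟨2, ?_⟩
    rw [pow_two, Ideal.zero_eq_bot, eq_bot_iff, Ideal.mul_le]
    intro y hy z hz
    exact hker y z hy hz
  -- Formal smoothness splits the square-zero extension. The expansion is made around the point `σ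
  -- (g (y i))`, where `f` and its derivatives vanish.
  let σ : L →ₐ[k] E := Algebra.FormallySmooth.liftOfSurjective (AlgHom.id k L) g hg hnil
  have hσ : ∀ y, g (σ y) = y := fun y =>
    Algebra.FormallySmooth.liftOfSurjective_apply (AlgHom.id k L) g hg hnil y
  have hdiff : ∀ p : MvPolynomial ι k, g (aeval y p - σ (g (aeval y p))) = 0 := fun p => by
    rw [map_sub, hσ, sub_self]
  rw [MvPolynomial.algHom_eq_add_sum_pderiv (aeval y) ((σ.comp g).comp (aeval y))
    (fun i j => hker _ _ (hdiff _) (hdiff _)) f, AlgHom.comp_apply, AlgHom.comp_apply, hf, map_zero,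
    zero_add]
  refine Finset.sum_eq_zero fun i _ => ?_
  rw [AlgHom.comp_apply, AlgHom.comp_apply, hd i, map_zero, zero_mul]

open MvPolynomial IsLocalRing in
theorem Algebra.FormallySmooth.aeval_mem_maximalIdeal_sq_of_pderiv {k T L ι : Type*} [CommRing k]
    [CommRing T] [IsLocalRing T] [Field L] [Algebra k T] [Algebra k L] [Finite ι]
    [Algebra.FormallySmooth k L] (w : T →ₐ[k] L) (hw : Function.Surjective w) (y : ι → T)
    (f : MvPolynomial ι k) (hf : w (aeval y f) = 0) (hd : ∀ i, w (aeval y (pderiv i f)) = 0) :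
    aeval y f ∈ maximalIdeal T ^ 2 := by
  have hker : RingHom.ker w = maximalIdeal T :=
    eq_maximalIdeal (RingHom.ker_isMaximal_of_surjective (w : T →+* L) hw)
  have hmem : ∀ z, w z = 0 ↔ z ∈ maximalIdeal T := fun z => by rw [← hker, RingHom.mem_ker]
  let g : (T ⧸ maximalIdeal T ^ 2) →ₐ[k] L := Ideal.Quotient.liftₐ _ w fun z hz =>
    (hmem z).2 (Ideal.pow_le_self two_ne_zero hz)
  have hg : ∀ z, g (Ideal.Quotient.mkₐ k _ z) = w z := fun z => rfl
  have haeval : ∀ p : MvPolynomial ι k, aeval (fun i => Ideal.Quotient.mkₐ k (maximalIdeal T ^ 2) (y i)) p =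
      Ideal.Quotient.mkₐ k (maximalIdeal T ^ 2) (aeval y p) := fun p => by
    rw [← AlgHom.comp_apply, comp_aeval]
  have h := Algebra.FormallySmooth.aeval_eq_zero_of_pderiv g
    (fun z => by
      obtain ⟨t, ht⟩ := hw z
      exact ⟨Ideal.Quotient.mkₐ k _ t, by rw [hg, ht]⟩)
    (fun a b ha hb => by
      obtain ⟨a, rfl⟩ := Ideal.Quotient.mkₐ_surjective k _ a
      obtain ⟨b, rfl⟩ := Ideal.Quotient.mkₐ_surjective k _ b
      rw [hg, hmem] at ha hb
      rw [← map_mul, Ideal.Quotient.mkₐ_eq_mk, Ideal.Quotient.eq_zero_iff_mem, pow_two]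
      exact Ideal.mul_mem_mul ha hb)
    (fun i => Ideal.Quotient.mkₐ k _ (y i)) f (by rw [haeval, hg, hf])
    (fun i => by rw [haeval, hg, hd])
  rwa [haeval, Ideal.Quotient.mkₐ_eq_mk, Ideal.Quotient.eq_zero_iff_mem] at h

theorem IsSeparableFieldExtension.formallySmooth {k K : Type*} [Field k] [Field K] [Algebra k K]
    (h : IsSeparableFieldExtension k K) {L : IntermediateField k K} (hL : L.FG) :
    Algebra.FormallySmooth k L := by
  obtain ⟨t, ht, hts⟩ := h L hL
  have : Algebra.IsSeparable (IntermediateField.adjoin k (Set.range ((↑) : t → L))) L := by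
    convert! hts <;> simp
  exact Algebra.FormallySmooth.of_algebraicIndependent_of_isSeparable ht.1

-- The local ring of affine space at `b` has residue field `k(b)`, which is formally smooth over
-- `k`; so `f` lies in the square of its maximal ideal. The factor `s` clears the denominators.
open MvPolynomial in
theorem exists_mul_mem_ker_sq_of_aeval_pderiv_eq_zero {k k' ι : Type*} [Field k] [Field k']
    [Algebra k k'] [Finite ι] (hsep : IsSeparableFieldExtension k k') (b : ι → k')
    (f : MvPolynomial ι k) (hf : aeval b f = 0) (hd : ∀ i, aeval b (pderiv i f) = 0) :
    ∃ s, aeval b s ≠ 0 ∧ s * f ∈ RingHom.ker (aeval (R := k) b) ^ 2 := by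
  let L := IntermediateField.adjoin k (Set.range b)
  have : Algebra.FormallySmooth k L :=
    hsep.formallySmooth (IntermediateField.fg_adjoin_of_finite (Set.finite_range b))
  let bL : ι → L := fun i => ⟨b i, IntermediateField.subset_adjoin _ _ ⟨i, rfl⟩⟩
  let v : MvPolynomial ι k →ₐ[k] L := aeval bL
  have hv : ∀ p, ((v p : L) : k') = aeval b p := fun p => by
    have : L.val.comp v = aeval b := by
      ext i
      simp [v, bL]
    exact DFunLike.congr_fun this p
  have hv0 : ∀ p, v p = 0 ↔ aeval b p = 0 := fun p => by
    rw [← hv p]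
    exact (ZeroMemClass.coe_eq_zero).symm
  have hker : RingHom.ker (aeval (R := k) b) = RingHom.ker v := by
    ext p
    rw [RingHom.mem_ker, RingHom.mem_ker, hv0]
  rw [hker]
  let q := RingHom.ker v
  have : q.IsPrime := RingHom.ker_isPrime v
  let T := Localization.AtPrime q
  let w : T →ₐ[k] L := IsLocalization.liftAlgHom (M := q.primeCompl) (f := v)
    (fun y => isUnit_iff_ne_zero.2 fun h => y.2 h)
  have hw : ∀ p, w (algebraMap _ T p) = v p := fun p => by
    simp [w]
  have hwsurj : Function.Surjective w := by
    intro y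
    obtain ⟨r, s, hrs⟩ := (IntermediateField.mem_adjoin_range_iff k b (y : k')).1 y.2
    -- Elements of `L` are fractions `r(b) / s(b)`; if `s(b) = 0`, division by zero makes the
    -- element `0`.
    by_cases hs : v s = 0
    · refine ⟨0, ?_⟩
      rw [(hv0 s).1 hs, div_zero] at hrs
      rw [map_zero]
      exact Subtype.ext hrs.symm
    · let s' : q.primeCompl := ⟨s, fun h => hs h⟩
      refine ⟨IsLocalization.mk' T r s', ?_⟩
      have h1 : w (IsLocalization.mk' T r s') * v s = v r := by
        rw [← hw, ← hw, ← map_mul, IsLocalization.mk'_spec T r s']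
      rw [← mul_left_inj' hs, h1]
      apply Subtype.ext
      rw [MulMemClass.coe_mul, hrs, hv, hv, div_mul_cancel₀ _ (mt (hv0 s).2 hs)]
  have haev : ∀ p : MvPolynomial ι k, aeval (fun i => algebraMap _ T (X i)) p = algebraMap _ T p :=
    fun p => (DFunLike.congr_fun
      (aeval_unique (IsScalarTower.toAlgHom k (MvPolynomial ι k) T)) p).symm
  have hzero := Algebra.FormallySmooth.aeval_mem_maximalIdeal_sq_of_pderiv w hwsurj
    (fun i => algebraMap _ T (X i)) f (by rw [haev, hw, hv0, hf])
    (fun i => by rw [haev, hw, hv0, hd])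
  rw [haev, ← Localization.AtPrime.map_eq_maximalIdeal, ← Ideal.map_pow,
    IsLocalization.algebraMap_mem_map_algebraMap_iff q.primeCompl] at hzero
  obtain ⟨s, hs, hsf⟩ := hzero
  exact ⟨s, fun h => hs ((hv0 s).2 h), hsf⟩

/-! ### Gradients at a point and their linear algebra. -/

/-- A linear dependence over a field `E` between vectors with coordinates in a subring
descends to that subring after clearing denominators. -/
theorem exists_smul_eq_sum_of_mem_span {S E ι κ : Type*} [CommRing S] [Field E] [Finite ι]
    [Fintype κ] (φ : S →+* E) (u : κ → ι → S) (w : ι → S)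
    (hu : LinearIndependent E (fun j i => φ (u j i)))
    (hw : (fun i => φ (w i)) ∈ Submodule.span E (Set.range fun j i => φ (u j i))) :
    ∃ t, φ t ≠ 0 ∧ ∃ a : κ → S, ∀ i, φ (t * w i) = φ (∑ j, a j * u j i) := by
  classical
  let D := φ.range
  let x : Option κ → ι → D := fun o i => φ.rangeRestrict (o.elim (w i) (fun j => u j i))
  have hx : ¬ LinearIndependent D x := by
    intro h
    have h1 : LinearIndependent E (fun o => algebraMap D E ∘ x o) :=
      linearIndependent_algebraMap_comp_iff.2 h
    have h2 := linearIndependent_option.1 h1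
    exact h2.2 hw
  rw [Fintype.linearIndependent_iff] at hx
  push Not at hx
  obtain ⟨c, hc, o, ho⟩ := hx
  choose d hd using fun o => φ.rangeRestrict_surjective (c o)
  have hd' : ∀ o, φ (d o) = c o := fun o => congrArg Subtype.val (hd o)
  have hrel : ∀ i, φ (d none) * φ (w i) + ∑ j, φ (d (some j)) * φ (u j i) = 0 := by
    intro i
    have h1 := congrArg Subtype.val (congrFun hc i)
    rw [Fintype.sum_option] at h1
    simp only [Pi.add_apply, Pi.smul_apply, Finset.sum_apply, smul_eq_mul] at h1
    push_cast at h1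
    simpa [hd', x] using h1
  refine ⟨d none, ?_, fun j => - d (some j), fun i => ?_⟩
  · intro h0
    have h1 : ∀ j, φ (d (some j)) = 0 := by
      rw [Fintype.linearIndependent_iff] at hu
      refine hu _ ?_
      ext i
      have := hrel i
      rw [h0, zero_mul, zero_add] at this
      simpa using this
    apply ho
    apply Subtype.ext
    rw [← hd']
    cases o with
    | none => exact h0
    | some j => exact h1 j
  · have := hrel i
    simp only [map_mul, map_sum, map_neg, neg_mul, Finset.sum_neg_distrib]
    linear_combination this

open MvPolynomial IsLocalRing

section EvalGrad

variable {R E ι : Type*} [CommRing R] [CommRing E] [Algebra R E]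

/-- The gradient of a polynomial evaluated at the point `b`. -/
noncomputable def evalGrad (b : ι → E) : MvPolynomial ι R →ₗ[R] ι → E :=
  LinearMap.pi fun i => (aeval b).toLinearMap ∘ₗ (pderiv i).toLinearMap

theorem evalGrad_apply (b : ι → E) (f : MvPolynomial ι R) (i : ι) :
    evalGrad b f i = aeval b (pderiv i f) := rfl

theorem evalGrad_mul (b : ι → E) (f g : MvPolynomial ι R) :
    evalGrad b (f * g) = aeval b f • evalGrad b g + aeval b g • evalGrad b f := by
  ext i
  simp [evalGrad_apply]

theorem evalGrad_mul_of_mem_ker (b : ι → E) (f : MvPolynomial ι R) {g : MvPolynomial ι R}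
    (hg : aeval b g = 0) : evalGrad b (f * g) = aeval b f • evalGrad b g := by
  rw [evalGrad_mul, hg, zero_smul, add_zero]

theorem evalGrad_algebraMap {E' : Type*} [CommRing E'] [Algebra R E'] [Algebra E E']
    [IsScalarTower R E E'] (b : ι → E) (f : MvPolynomial ι R) (i : ι) :
    evalGrad (fun i => algebraMap E E' (b i)) f i = algebraMap E E' (evalGrad b f i) :=
  aeval_algebraMap_apply E' b (pderiv i f)

theorem evalGrad_map {R' : Type*} [CommRing R'] [Algebra R R'] [Algebra R' E]
    [IsScalarTower R R' E] (b : ι → E) (f : MvPolynomial ι R) :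
    evalGrad b (map (algebraMap R R') f) = evalGrad b f := by
  ext i
  rw [evalGrad_apply, evalGrad_apply, pderiv_map, aeval_map_algebraMap]

end EvalGrad

section Field

variable {R E ι : Type*} [CommRing R] [Field E] [Algebra R E] [Finite ι]

theorem exists_evalGrad_eq_zero_of_mem_span {κ : Type*} [Fintype κ] (b : ι → E)
    (f : κ → MvPolynomial ι R) (hf : ∀ j, aeval b (f j) = 0)
    (hli : LinearIndependent E fun j => evalGrad b (f j)) (q : MvPolynomial ι R)
    (hq : aeval b q = 0)
    (hspan : evalGrad b q ∈ Submodule.span E (Set.range fun j => evalGrad b (f j))) :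
    ∃ s, aeval b s ≠ 0 ∧ ∃ a : κ → MvPolynomial ι R,
      evalGrad b (s * q - ∑ j, a j * f j) = 0 := by
  obtain ⟨s, hs, a, ha⟩ := exists_smul_eq_sum_of_mem_span (aeval (R := R) b : _ →+* E)
    (fun j i => pderiv i (f j)) (fun i => pderiv i q) hli hspan
  refine ⟨s, hs, a, ?_⟩
  ext i
  have := ha i
  rw [map_sub, map_sum, evalGrad_mul_of_mem_ker b s hq,
    Finset.sum_congr rfl fun j _ => evalGrad_mul_of_mem_ker b (a j) (hf j)]
  simp only [Pi.sub_apply, Pi.smul_apply, Finset.sum_apply, smul_eq_mul, evalGrad_apply,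
    Pi.zero_apply, sub_eq_zero]
  simpa using this

/-- An ideal of polynomials vanishing at `b` contains finitely many elements whose gradients
form, up to denominators, a basis of all its gradients. -/
theorem exists_linearIndependent_evalGrad (b : ι → E) (J : Ideal (MvPolynomial ι R))
    (hJ : ∀ q ∈ J, aeval b q = 0) :
    ∃ (c : ℕ) (f : Fin c → MvPolynomial ι R), (∀ j, f j ∈ J) ∧
      LinearIndependent E (fun j => evalGrad b (f j)) ∧
      ∀ q ∈ J, ∃ s, aeval b s ≠ 0 ∧ ∃ a : Fin c → MvPolynomial ι R,
        evalGrad b (s * q - ∑ j, a j * f j) = 0 := by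
  obtain ⟨t, htJ, htspan, htli⟩ := exists_linearIndependent E
    (evalGrad b '' (J : Set (MvPolynomial ι R)))
  have : Finite t := htli.finite
  let e := Finite.equivFin t
  choose g hgJ hg using fun y : t => htJ y.2
  have hli : LinearIndependent E fun j => evalGrad b (g (e.symm j)) := by
    simp only [hg]
    exact htli.comp _ e.symm.injective
  refine ⟨Nat.card t, fun j => g (e.symm j), fun j => hgJ _, hli, fun q hq => ?_⟩
  refine exists_evalGrad_eq_zero_of_mem_span b _ (fun j => hJ _ (hgJ _)) hli q (hJ q hq) ?_
  have hr : (Set.range fun j => evalGrad b (g (e.symm j))) = t := by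
    ext y
    constructor
    · rintro ⟨j, rfl⟩
      simp only [hg]
      exact (e.symm j).2
    · intro hy
      exact ⟨e ⟨y, hy⟩, by simp only [hg, Equiv.symm_apply_apply]⟩
  rw [hr, htspan]
  exact Submodule.subset_span ⟨q, hq, rfl⟩

end Field

/-! ### Separability of the residue fields and of the fraction fields. -/

/-- The field case applies after reducing coefficients; lifting back costs the kernel of the
reduction, which is the second summand. -/
theorem exists_mul_mem_sq_sup_of_evalGrad_mem_maximalIdeal {A A' ι : Type*} [CommRing A]
    [CommRing A'] [IsLocalRing A] [IsLocalRing A'] [Algebra A A'] [IsLocalHom (algebraMap A A')]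
    [Finite ι] (hres : IsSeparableFieldExtension (ResidueField A) (ResidueField A')) (b : ι → A')
    (f : MvPolynomial ι A) (hf : aeval b f ∈ maximalIdeal A')
    (hd : ∀ i, evalGrad b f i ∈ maximalIdeal A') :
    ∃ s, aeval b s ∉ maximalIdeal A' ∧
      s * f ∈ (maximalIdeal A').comap (aeval (R := A) b) ^ 2 ⊔ (maximalIdeal A).map C := by
  let b' : ι → ResidueField A' := fun i => algebraMap A' _ (b i)
  let ρ : MvPolynomial ι A →+* MvPolynomial ι (ResidueField A) := map (algebraMap A _)
  have hρ : Function.Surjective ρ := map_surjective _ residue_surjective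
  have hev : ∀ p, aeval b' (ρ p) = algebraMap A' (ResidueField A') (aeval b p) := fun p => by
    rw [aeval_map_algebraMap]
    exact aeval_algebraMap_apply _ b p
  have hz : ∀ z, algebraMap A' (ResidueField A') z = 0 ↔ z ∈ maximalIdeal A' :=
    fun z => residue_eq_zero_iff z
  obtain ⟨s, hs, hsf⟩ := exists_mul_mem_ker_sq_of_aeval_pderiv_eq_zero hres b' (ρ f)
    (by rw [hev, hz]; exact hf) (fun i => by rw [pderiv_map, hev, hz]; exact hd i)
  obtain ⟨s, rfl⟩ := hρ s
  refine ⟨s, by rwa [hev, Ne, hz] at hs, ?_⟩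
  have hker : RingHom.ker (aeval (R := ResidueField A) b') =
      ((maximalIdeal A').comap (aeval (R := A) b)).map ρ := by
    rw [← Ideal.map_comap_of_surjective ρ hρ (RingHom.ker (aeval (R := ResidueField A) b'))]
    congr 1
    ext p
    rw [Ideal.mem_comap, RingHom.mem_ker, hev, hz, Ideal.mem_comap]
  rw [hker, ← Ideal.map_pow, ← map_mul, Ideal.mem_map_iff_of_surjective ρ hρ] at hsf
  obtain ⟨p, hp, hpe⟩ := hsf
  have hkρ : RingHom.ker ρ = (maximalIdeal A).map C := by
    rw [MvPolynomial.ker_map]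
    congr 1
    exact ker_residue
  rw [← sub_add_cancel (s * f) p, add_comm]
  refine Submodule.add_mem_sup hp ?_
  rw [← hkρ, RingHom.mem_ker, map_sub, hpe, sub_self]

-- `K[X]` is the localization of `A[X]` at nonzero constants, so the field case over `K` descends
-- after clearing denominators.
attribute [local instance] MvPolynomial.algebraMvPolynomial in
theorem exists_mul_mem_ker_sq_of_evalGrad_eq_zero {A A' K K' ι : Type*} [CommRing A] [IsDomain A]
    [CommRing A'] [Algebra A A'] [Field K] [Field K'] [Algebra A K] [IsFractionRing A K]
    [Algebra A' K'] [FaithfulSMul A' K'] [Algebra A K'] [Algebra K K'] [IsScalarTower A A' K']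
    [IsScalarTower A K K'] [Finite ι] (hfrac : IsSeparableFieldExtension K K') (b : ι → A')
    (f : MvPolynomial ι A) (hf : aeval b f = 0) (hd : evalGrad b f = 0) :
    ∃ s, aeval b s ≠ 0 ∧ s * f ∈ RingHom.ker (aeval (R := A) b) ^ 2 := by
  let b' : ι → K' := fun i => algebraMap A' _ (b i)
  have hinj : Function.Injective (algebraMap A' K') := FaithfulSMul.algebraMap_injective A' K'
  let ρ : MvPolynomial ι A →+* MvPolynomial ι K := map (algebraMap A _)
  have hev : ∀ p, aeval b' (ρ p) = algebraMap A' K' (aeval b p) := fun p => by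
    rw [aeval_map_algebraMap]
    exact aeval_algebraMap_apply _ b p
  have hz : ∀ z, algebraMap A' K' z = 0 ↔ z = 0 := fun z => by
    rw [← map_zero (algebraMap A' K'), hinj.eq_iff]
  obtain ⟨s, hs, hsf⟩ := exists_mul_mem_ker_sq_of_aeval_pderiv_eq_zero hfrac b' (ρ f)
    (by rw [hev, hz]; exact hf)
    (fun i => by rw [pderiv_map, hev, hz]; exact congrFun hd i)
  let M := (nonZeroDivisors A).map (C (σ := ι))
  have hloc : IsLocalization M (MvPolynomial ι K) := inferInstance
  have hker : RingHom.ker (aeval (R := K) b') = (RingHom.ker (aeval (R := A) b)).map ρ := by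
    rw [← IsLocalization.map_under M _ (RingHom.ker (aeval (R := K) b')), Ideal.under_def]
    congr 1
    ext p
    rw [Ideal.mem_comap, RingHom.mem_ker, RingHom.mem_ker]
    exact (iff_of_eq (congrArg (· = 0) (hev p))).trans (hz _)
  obtain ⟨⟨s', m⟩, hm⟩ := IsLocalization.surj M s
  have hm' : s * ρ m = ρ s' := hm
  have hmu : aeval b' (ρ m) ≠ 0 := by
    have : IsUnit (ρ m) := IsLocalization.map_units (M := M) _ m
    exact (this.map (aeval b')).ne_zero
  have h1 : ρ (s' * f) ∈ (RingHom.ker (aeval (R := A) b) ^ 2).map ρ := by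
    rw [Ideal.map_pow, ← hker, map_mul, ← hm', mul_right_comm]
    exact Ideal.mul_mem_right _ _ hsf
  obtain ⟨n, hn, h2⟩ := (IsLocalization.algebraMap_mem_map_algebraMap_iff M
    (MvPolynomial ι K) _ _).1 h1
  have hnu : aeval b' (ρ n) ≠ 0 := by
    have : IsUnit (ρ n) := IsLocalization.map_units (M := M) _ ⟨n, hn⟩
    exact (this.map (aeval b')).ne_zero
  refine ⟨n * s', fun h => ?_, by rwa [mul_assoc]⟩
  have h3 : aeval b' (ρ (n * s')) = 0 := by rw [hev, h, map_zero]
  rw [map_mul, ← hm', map_mul, map_mul] at h3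
  exact mul_ne_zero hnu (mul_ne_zero hs hmu) h3

/-! ### Torsion submodules and their length. -/

theorem Submodule.mem_torsion_iff_exists_ne_zero {E V : Type*} [CommRing E] [IsDomain E]
    [AddCommGroup V] [Module E V] {y : V} :
    y ∈ Submodule.torsion E V ↔ ∃ a : E, a ≠ 0 ∧ a • y = 0 := by
  rw [Submodule.mem_torsion_iff]
  constructor
  · rintro ⟨a, ha⟩
    exact ⟨a, nonZeroDivisors.coe_ne_zero a, ha⟩
  · rintro ⟨a, ha, hay⟩
    exact ⟨⟨a, mem_nonZeroDivisors_of_ne_zero ha⟩, hay⟩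

theorem isArtinianRing_quotient_of_ne_bot {E : Type*} [CommRing E] [IsDomain E]
    [IsNoetherianRing E] [Ring.DimensionLEOne E] {I : Ideal E} (hI : I ≠ ⊥) :
    IsArtinianRing (E ⧸ I) := by
  rw [isArtinianRing_iff_krullDimLE_zero, Ring.krullDimLE_zero_iff]
  intro J hJ
  have hp : (J.comap (Ideal.Quotient.mk I)).IsPrime := Ideal.comap_isPrime _ _
  have hmax : (J.comap (Ideal.Quotient.mk I)).IsMaximal := by
    refine Ring.DimensionLEOne.maximalOfPrime (fun h => hI ?_) hp
    rw [eq_bot_iff, ← h]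
    intro x hx
    rw [Ideal.mem_comap, Ideal.Quotient.eq_zero_iff_mem.2 hx]
    exact zero_mem J
  rw [← Ideal.map_comap_of_surjective _ Ideal.Quotient.mk_surjective J]
  refine (Ideal.map_eq_top_or_isMaximal_of_surjective _ Ideal.Quotient.mk_surjective
    hmax).resolve_left fun h => hJ.ne_top ?_
  rwa [Ideal.map_comap_of_surjective _ Ideal.Quotient.mk_surjective] at h

/-- A single nonzero `c` kills the torsion, which is thus finite over the Artinian ring `E/(c)`. -/
theorem isArtinian_torsion (E V : Type*) [CommRing E] [IsDomain E] [IsNoetherianRing E]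
    [Ring.DimensionLEOne E] [AddCommGroup V] [Module E V] [Module.Finite E V] :
    IsArtinian E (Submodule.torsion E V) := by
  obtain ⟨c, hcann, hc⟩ := Submodule.annihilator_top_inter_nonZeroDivisors
    (Submodule.torsion_isTorsion (R := E) (M := V))
  have htor : Module.IsTorsionBySet E (Submodule.torsion E V) (Ideal.span {c} : Ideal E) := by
    rw [Module.isTorsionBySet_span_singleton_iff]
    exact fun y => Submodule.mem_annihilator.1 hcann y Submodule.mem_top
  let := htor.module
  have : IsScalarTower E (E ⧸ Ideal.span {c}) (Submodule.torsion E V) := htor.isScalarTower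
  have : IsArtinianRing (E ⧸ Ideal.span {c}) :=
    isArtinianRing_quotient_of_ne_bot (by simpa using nonZeroDivisors.ne_zero hc)
  have : Module.Finite (E ⧸ Ideal.span {c}) (Submodule.torsion E V) :=
    Module.Finite.of_restrictScalars_finite E _ _
  exact isArtinian_of_surjective_algebraMap (R := E ⧸ Ideal.span {c})
    Ideal.Quotient.mk_surjective

/-- Since `ker Ψ ≤ N'`, `F'/N'` embeds in `F/Ψ(N')`. Since `Ψ(N')/N` is torsion, the torsion of
`F/N` surjects onto that of `F/Ψ(N')`; the kernel contains the nonzero class of `r₀`, and finite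
length makes the drop strict. -/
theorem length_torsion_quotient_lt {E F F' : Type*} [CommRing E] [IsDomain E] [AddCommGroup F]
    [AddCommGroup F'] [Module E F] [Module E F'] (N : Submodule E F) (N' : Submodule E F')
    (Ψ : F' →ₗ[E] F) (hker : LinearMap.ker Ψ ≤ N') (hle : N ≤ N'.map Ψ)
    (htors : ∀ r ∈ N', ∃ a : E, a ≠ 0 ∧ a • Ψ r ∈ N) (r₀ : F) (h₀ : r₀ ∈ N'.map Ψ) (h₀' : r₀ ∉ N)
    [IsNoetherianRing E] [Ring.DimensionLEOne E] [Module.Finite E F] :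
    Module.length E (Submodule.torsion E (F' ⧸ N')) <
      Module.length E (Submodule.torsion E (F ⧸ N)) := by
  let α : (F' ⧸ N') →ₗ[E] (F ⧸ N'.map Ψ) := N'.mapQ _ Ψ (Submodule.le_comap_map _ _)
  let β : (F ⧸ N) →ₗ[E] (F ⧸ N'.map Ψ) := Submodule.factor hle
  have hαt : ∀ y ∈ Submodule.torsion E (F' ⧸ N'), α y ∈ Submodule.torsion E (F ⧸ N'.map Ψ) := by
    intro y hy
    rw [Submodule.mem_torsion_iff_exists_ne_zero] at hy ⊢
    obtain ⟨a, ha, hay⟩ := hy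
    exact ⟨a, ha, by rw [← map_smul, hay, map_zero]⟩
  have hβt : ∀ y ∈ Submodule.torsion E (F ⧸ N), β y ∈ Submodule.torsion E (F ⧸ N'.map Ψ) := by
    intro y hy
    rw [Submodule.mem_torsion_iff_exists_ne_zero] at hy ⊢
    obtain ⟨a, ha, hay⟩ := hy
    exact ⟨a, ha, by rw [← map_smul, hay, map_zero]⟩
  have hαinj : Function.Injective α := by
    rw [← LinearMap.ker_eq_bot, LinearMap.ker_eq_bot']
    intro y hy
    obtain ⟨y, rfl⟩ := N'.mkQ_surjective y
    change (N'.map Ψ).mkQ (Ψ y) = 0 at hy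
    rw [Submodule.mkQ_apply, Submodule.Quotient.mk_eq_zero] at hy
    obtain ⟨z, hz, hzy⟩ := hy
    rw [Submodule.mkQ_apply, Submodule.Quotient.mk_eq_zero, ← sub_add_cancel y z]
    refine add_mem (hker ?_) hz
    rw [LinearMap.mem_ker, map_sub, hzy, sub_self]
  have hβsurj : Function.Surjective (β.restrict hβt) := by
    rintro ⟨y, hy⟩
    obtain ⟨y, rfl⟩ := (N'.map Ψ).mkQ_surjective y
    obtain ⟨a, ha, hay⟩ := Submodule.mem_torsion_iff_exists_ne_zero.1 hy
    rw [← map_smul, Submodule.mkQ_apply, Submodule.Quotient.mk_eq_zero] at hay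
    obtain ⟨r, hr, hre⟩ := hay
    obtain ⟨a', ha', hr'⟩ := htors r hr
    refine ⟨⟨N.mkQ y, Submodule.mem_torsion_iff_exists_ne_zero.2 ⟨a' * a, mul_ne_zero ha' ha, ?_⟩⟩, rfl⟩
    rw [← map_smul, Submodule.mkQ_apply, Submodule.Quotient.mk_eq_zero, mul_smul, ← hre]
    exact hr'
  have hβker : LinearMap.ker (β.restrict hβt) ≠ ⊥ := by
    intro hbot
    obtain ⟨r, hr, hre⟩ := h₀
    obtain ⟨a, ha, har⟩ := htors r hr
    have hmem₀ : N.mkQ r₀ ∈ Submodule.torsion E (F ⧸ N) := by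
      refine Submodule.mem_torsion_iff_exists_ne_zero.2 ⟨a, ha, ?_⟩
      rwa [← map_smul, Submodule.mkQ_apply, Submodule.Quotient.mk_eq_zero, ← hre]
    have h1 : (⟨N.mkQ r₀, hmem₀⟩ : Submodule.torsion E (F ⧸ N)) ∈ LinearMap.ker (β.restrict hβt) := by
      rw [LinearMap.mem_ker]
      apply Subtype.ext
      change (N'.map Ψ).mkQ r₀ = 0
      rw [Submodule.mkQ_apply, Submodule.Quotient.mk_eq_zero]
      exact ⟨r, hr, hre⟩
    rw [hbot, Submodule.mem_bot] at h1
    have h2 : N.mkQ r₀ = 0 := congrArg Subtype.val h1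
    rw [Submodule.mkQ_apply, Submodule.Quotient.mk_eq_zero] at h2
    exact h₀' h2
  have := isArtinian_torsion E (F ⧸ N)
  calc Module.length E (Submodule.torsion E (F' ⧸ N'))
      ≤ Module.length E (Submodule.torsion E (F ⧸ N'.map Ψ)) :=
        Module.length_le_of_injective (α.restrict hαt) fun y z hyz =>
          Subtype.ext (hαinj (congrArg Subtype.val hyz))
    _ = Module.length E (Submodule.torsion E (F ⧸ N) ⧸ LinearMap.ker (β.restrict hβt)) :=
        ((β.restrict hβt).quotKerEquivOfSurjective hβsurj).length_eq.symm
    _ < _ := Submodule.length_quotient_lt _ hβker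

/-- Nakayama's lemma in the localization at `P`, with denominators cleared. -/
theorem exists_mul_mem_of_forall_exists_mul_mem_sup_sq {S : Type*} [CommRing S]
    [IsNoetherianRing S] (P J : Ideal S) [P.IsPrime]
    (h : ∀ q ∈ P, ∃ s ∉ P, s * q ∈ J ⊔ P ^ 2) : ∀ q ∈ P, ∃ s ∉ P, s * q ∈ J := by
  let T := Localization.AtPrime P
  have hle : maximalIdeal T ≤ J.map (algebraMap S T) := by
    refine Submodule.le_of_le_smul_of_le_jacobson_bot (I := maximalIdeal T)
      (IsNoetherian.noetherian _) (maximalIdeal_le_jacobson _) ?_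
    rw [smul_eq_mul, ← pow_two, ← Localization.AtPrime.map_eq_maximalIdeal, ← Ideal.map_pow]
    change _ ≤ J.map (algebraMap S T) ⊔ (P ^ 2).map (algebraMap S T)
    rw [← Ideal.map_sup, Ideal.map_le_iff_le_comap]
    intro q hq
    exact (IsLocalization.algebraMap_mem_map_algebraMap_iff P.primeCompl T _ _).2 (h q hq)
  intro q hq
  refine (IsLocalization.algebraMap_mem_map_algebraMap_iff P.primeCompl T _ _).1 (hle ?_)
  rw [← Localization.AtPrime.map_eq_maximalIdeal]
  exact Ideal.mem_map_of_mem _ hq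

/-! ### Gradient relations and the Jacobian criterion for regularity. -/

/-- The module of relations between the differentials `d (b i)` in the algebra generated by the
family `b`. -/
def gradRelations (R : Type*) {E ι : Type*} [CommRing R] [CommRing E] [Algebra R E] (b : ι → E) :
    Submodule E (ι → E) :=
  Submodule.span E (evalGrad b '' {f : MvPolynomial ι R | aeval b f = 0})

theorem evalGrad_mem_gradRelations {R E ι : Type*} [CommRing R] [CommRing E] [Algebra R E]
    (b : ι → E) {f : MvPolynomial ι R} (hf : aeval b f = 0) :
    evalGrad b f ∈ gradRelations R b :=
  Submodule.subset_span ⟨f, hf, rfl⟩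

section Residue

variable {A A' ι : Type*} [CommRing A] [CommRing A'] [IsLocalRing A'] [Algebra A A']

theorem aeval_residue (b : ι → A') (f : MvPolynomial ι A) :
    aeval (fun i => residue A' (b i)) f = residue A' (aeval b f) :=
  aeval_algebraMap_apply (ResidueField A') b f

theorem evalGrad_residue (b : ι → A') (f : MvPolynomial ι A) (i : ι) :
    evalGrad (fun i => residue A' (b i)) f i = residue A' (evalGrad b f i) :=
  evalGrad_algebraMap (E' := ResidueField A') b f i

/-- Choose relations `f j` whose gradients form a basis of all relation gradients over the residue
field. Up to a unit, any other gradient is a combination of these plus `ϖ • r`. If the first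
alternative fails, `r` is again in the module of relations, and Nakayama applies. -/
theorem exists_gradRelations_dichotomy [IsDomain A'] [IsNoetherianRing A'] [Finite ι] (ϖ : A')
    (hϖ : maximalIdeal A' = Ideal.span {ϖ}) (b : ι → A') :
    (∃ (f : MvPolynomial ι A) (r : ι → A'), aeval b f = 0 ∧ evalGrad b f = ϖ • r ∧
      r ∉ gradRelations A b) ∨
    ∃ (c : ℕ) (f : Fin c → MvPolynomial ι A), (∀ j, aeval b (f j) = 0) ∧
      LinearIndependent (ResidueField A') (fun j => evalGrad (fun i => residue A' (b i)) (f j)) ∧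
      gradRelations A b ≤ Submodule.span A' (Set.range fun j => evalGrad b (f j)) := by
  refine or_iff_not_imp_left.2 fun hcon => ?_
  push Not at hcon
  obtain ⟨c, f, hf, hli, hspan⟩ := exists_linearIndependent_evalGrad
    (fun i => residue A' (b i)) (RingHom.ker (aeval (R := A) b)) (fun q hq => by
      rw [aeval_residue, (RingHom.mem_ker).1 hq, map_zero])
  refine ⟨c, f, hf, hli, ?_⟩
  refine Submodule.le_of_le_smul_of_le_jacobson_bot (I := maximalIdeal A')
    (IsNoetherian.noetherian _) (maximalIdeal_le_jacobson _) ?_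
  refine Submodule.span_le.2 ?_
  rintro _ ⟨q, hq, rfl⟩
  have hq0 : aeval b q = 0 := hq
  obtain ⟨s, hs, a, ha⟩ := hspan q hq
  rw [aeval_residue, Ne, residue_eq_zero_iff, mem_maximalIdeal, mem_nonunits_iff, not_not] at hs
  have hdiv : ∀ i, ∃ z, evalGrad b (s * q - ∑ j, a j * f j) i = ϖ * z := fun i => by
    have h1 := congrFun ha i
    rw [evalGrad_residue, Pi.zero_apply, residue_eq_zero_iff, hϖ,
      Ideal.mem_span_singleton] at h1
    exact h1
  choose r hr using hdiv
  have hr' : evalGrad b (s * q - ∑ j, a j * f j) = ϖ • r := funext hr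
  have hz : aeval b (s * q - ∑ j, a j * f j) = 0 := by
    rw [map_sub, map_sum, map_mul, hq0, mul_zero, zero_sub, neg_eq_zero]
    exact Finset.sum_eq_zero fun j _ => by rw [map_mul, (RingHom.mem_ker).1 (hf j), mul_zero]
  have hrR := hcon _ r hz hr'
  have hexp : aeval b s • evalGrad b q = ∑ j, aeval b (a j) • evalGrad b (f j) + ϖ • r := by
    rw [← hr', map_sub, map_sum, evalGrad_mul_of_mem_ker b s hq0,
      Finset.sum_congr rfl fun j _ => evalGrad_mul_of_mem_ker b (a j) ((RingHom.mem_ker).1 (hf j))]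
    abel
  rw [SetLike.mem_coe, ← Submodule.smul_mem_iff_of_isUnit _ hs, hexp]
  refine Submodule.add_mem_sup (Submodule.sum_mem _ fun j _ => Submodule.smul_mem _ _
    (Submodule.subset_span ⟨j, rfl⟩)) (Submodule.smul_mem_smul ?_ hrR)
  rw [hϖ]
  exact Ideal.mem_span_singleton_self ϖ

theorem evalGrad_eq_zero_of_mem_sq {E : Type*} [CommRing E] [Algebra A E] (b : ι → E)
    (P : Ideal (MvPolynomial ι A)) (hP : ∀ p ∈ P, aeval b p = 0) {f : MvPolynomial ι A}
    (hf : f ∈ P ^ 2) : evalGrad b f = 0 := by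
  rw [pow_two] at hf
  refine Submodule.mul_induction_on hf (fun p hp q hq => ?_) fun p q hp hq => ?_
  · rw [evalGrad_mul, hP p hp, hP q hq, zero_smul, zero_smul, add_zero]
  · rw [map_add, hp, hq, add_zero]

end Residue

theorem linearIndependent_of_residue {E ι κ : Type*} [CommRing E] [IsLocalRing E] [Finite ι]
    (v : κ → ι → E) (h : LinearIndependent (ResidueField E) fun j i => residue E (v j i)) :
    LinearIndependent E v := by
  classical
  cases nonempty_fintype ι
  refine Module.IsLocalRing.linearIndependent_of_flat v ?_
  refine LinearIndependent.of_comp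
    (TensorProduct.piScalarRight E (ResidueField E) (ResidueField E) ι).toLinearMap ?_
  convert! h using 3 with j i
  simp [Algebra.smul_def]

/-- The `f j` are independent in the cotangent space of the regular ring `T`, so `T/Q` is regular,
hence a domain. It remains to identify `Q` with the kernel of `T` onto the local ring of `A[b]`:
generic equality suffices because `Q` is prime. -/
theorem isRegularLocalRing_of_linearIndependent_evalGrad {A A' K K' ι : Type*} [CommRing A]
    [IsDomain A] [IsRegularRing A] [CommRing A'] [IsDomain A'] [IsLocalRing A'] [Algebra A A']
    [FaithfulSMul A A'] [Field K] [Field K'] [Algebra A K]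
    [IsFractionRing A K] [Algebra A' K'] [IsFractionRing A' K'] [Algebra A K'] [Algebra K K']
    [IsScalarTower A A' K'] [IsScalarTower A K K'] [Finite ι]
    (hfrac : IsSeparableFieldExtension K K') (b : ι → A') {c : ℕ}
    (f : Fin c → MvPolynomial ι A) (hf : ∀ j, aeval b (f j) = 0)
    (hli : LinearIndependent (ResidueField A')
      (fun j => evalGrad (fun i => residue A' (b i)) (f j)))
    (hspan : gradRelations A b ≤ Submodule.span A' (Set.range fun j => evalGrad b (f j))) :
    IsRegularLocalRing (Localization.AtPrime
      ((maximalIdeal A').comap (algebraMap (aeval (R := A) b).range A'))) := by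
  let C := (aeval (R := A) b).range
  let p := (maximalIdeal A').comap (algebraMap C A')
  let φ : MvPolynomial ι A →+* C := (aeval (R := A) b).rangeRestrict
  have hφ : Function.Surjective φ := (aeval (R := A) b).rangeRestrict_surjective
  let P := (maximalIdeal A').comap (aeval (R := A) b)
  have hPp : P = p.comap φ := rfl
  let T := Localization.AtPrime P
  have hFm : ∀ j, algebraMap _ T (f j) ∈ maximalIdeal T := fun j => by
    rw [← Localization.AtPrime.map_eq_maximalIdeal]
    refine Ideal.mem_map_of_mem _ ?_
    rw [Ideal.mem_comap, hf]
    exact zero_mem _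
  have hPres : ∀ q, q ∈ P ↔ aeval (fun i => residue A' (b i)) q = 0 := fun q => by
    rw [aeval_residue, residue_eq_zero_iff, Ideal.mem_comap]
  obtain ⟨_, -⟩ := IsRegularLocalRing.quotient_span_range (fun j => algebraMap _ T (f j)) hFm (by
    intro a ha i
    -- With denominators cleared, the gradient over the residue field can be applied; it annihilates
    -- `P ^ 2`.
    obtain ⟨d, hd⟩ := IsLocalization.exist_integer_multiples_of_finite P.primeCompl a
    choose a' ha' using hd
    have h1 : algebraMap _ T (∑ j, a' j * f j) ∈ (P ^ 2).map (algebraMap _ T) := by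
      rw [Ideal.map_pow, Localization.AtPrime.map_eq_maximalIdeal]
      have h2 := Ideal.mul_mem_left _ (algebraMap (MvPolynomial ι A) T d) ha
      convert h2 using 1
      rw [map_sum, Finset.mul_sum]
      refine Finset.sum_congr rfl fun j _ => ?_
      rw [map_mul, ha', Algebra.smul_def, mul_assoc]
    obtain ⟨m, hm, hmem⟩ :=
      (IsLocalization.algebraMap_mem_map_algebraMap_iff P.primeCompl T _ _).1 h1
    have h3 := evalGrad_eq_zero_of_mem_sq (fun i => residue A' (b i)) P
      (fun q hq => (hPres q).1 hq) hmem
    have hfr : ∀ j, aeval (fun i => residue A' (b i)) (f j) = 0 := fun j => by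
      rw [aeval_residue, hf, map_zero]
    rw [Finset.mul_sum, map_sum, Finset.sum_congr rfl fun j _ => by
      rw [← mul_assoc, evalGrad_mul_of_mem_ker _ _ (hfr j)]] at h3
    have h4 := Fintype.linearIndependent_iff.1 hli _ h3 i
    rw [← hPres] at h4
    have h5 : a' i ∈ P := ((inferInstance : P.IsPrime).mem_or_mem h4).resolve_left hm
    have h6 : algebraMap _ T (d : MvPolynomial ι A) * a i ∈ maximalIdeal T := by
      rw [← Algebra.smul_def]
      change (d : MvPolynomial ι A) • a i ∈ _
      rw [← ha', ← Localization.AtPrime.map_eq_maximalIdeal]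
      exact Ideal.mem_map_of_mem _ h5
    exact (Ideal.unit_mul_mem_iff_mem _ (IsLocalization.map_units T d)).1 h6)
  set Q := Ideal.span (Set.range fun j => algebraMap _ T (f j)) with hQ
  have hdom : IsDomain (T ⧸ Q) := IsRegularLocalRing.isDomain (T ⧸ Q)
  have hQp : Q.IsPrime := (Ideal.Quotient.isDomain_iff_prime _).1 hdom
  let w : T →+* Localization.AtPrime p := Localization.localRingHom P p φ hPp
  have hw : ∀ q, w (algebraMap _ T q) = algebraMap C _ (φ q) := fun q =>
    Localization.localRingHom_to_map P p φ hPp q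
  have hCinj : Function.Injective (algebraMap C (Localization.AtPrime p)) :=
    IsLocalization.injective _ p.primeCompl_le_nonZeroDivisors
  have hw0 : ∀ q, w (algebraMap _ T q) = 0 ↔ aeval b q = 0 := fun q => by
    rw [hw, map_eq_zero_iff _ hCinj]
    exact (Subtype.ext_iff (a1 := φ q) (a2 := 0))
  have hQw : Q ≤ RingHom.ker w := by
    rw [hQ, Ideal.span_le]
    rintro _ ⟨j, rfl⟩
    exact (hw0 _).2 (hf j)
  let I := RingHom.ker (aeval (R := A) b)
  have hIp : I.IsPrime := RingHom.ker_isPrime _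
  let b' : ι → K' := fun i => algebraMap A' K' (b i)
  have hinj : Function.Injective (algebraMap A' K') := IsFractionRing.injective A' K'
  have hev : ∀ q : MvPolynomial ι A, aeval b' q = algebraMap A' K' (aeval b q) := fun q =>
    aeval_algebraMap_apply K' b q
  have hliK : LinearIndependent K' fun j => evalGrad b' (f j) := by
    have h1 : LinearIndependent K' fun j => algebraMap A' K' ∘ evalGrad b (f j) :=
      linearIndependent_algebraMap_comp_iff.2 (linearIndependent_of_residue _ (by
        convert! hli using 3 with j i
        exact (evalGrad_residue b (f j) i).symm))
    convert! h1 using 2 with j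
    ext i
    exact evalGrad_algebraMap (E' := K') b (f j) i
  have hIQ : ∀ g ∈ I, algebraMap _ T g ∈ Q := by
    intro g hg
    -- At the generic point, the gradients of the `f j` span those of `I`. Subtracting a combination
    -- leaves zero gradient, hence an element locally in `I ^ 2` by separability of `K'` over `K`.
    obtain ⟨t, ht, htg⟩ := exists_mul_mem_of_forall_exists_mul_mem_sup_sq I
      (Ideal.span (Set.range f)) (by
        intro g hg
        have hg0 : aeval b g = 0 := hg
        have hgb : aeval b' g = 0 := by rw [hev, hg0, map_zero]
        obtain ⟨s, hs, a, ha⟩ := exists_evalGrad_eq_zero_of_mem_span b' f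
          (fun j => by rw [hev, hf, map_zero]) hliK g hgb (by
            obtain ⟨e, he⟩ := (Submodule.mem_span_range_iff_exists_fun _).1
              (hspan (evalGrad_mem_gradRelations b hg0))
            refine (Submodule.mem_span_range_iff_exists_fun _).2 ⟨fun j => algebraMap A' K' (e j), ?_⟩
            ext i
            rw [evalGrad_algebraMap (E' := K') b g i, ← he]
            simp only [Finset.sum_apply, Pi.smul_apply, smul_eq_mul, map_sum, map_mul, b',
              evalGrad_algebraMap (E' := K') b])
        have hg1 : aeval b (s * g - ∑ j, a j * f j) = 0 := by
          rw [map_sub, map_sum, map_mul, hg0, mul_zero, zero_sub, neg_eq_zero]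
          exact Finset.sum_eq_zero fun j _ => by rw [map_mul, hf j, mul_zero]
        obtain ⟨s', hs', hmem⟩ := exists_mul_mem_ker_sq_of_evalGrad_eq_zero hfrac b
          (s * g - ∑ j, a j * f j) hg1 (by
            ext i
            have h1 := congrFun ha i
            rwa [evalGrad_algebraMap (E' := K') b, Pi.zero_apply, map_eq_zero_iff _ hinj] at h1)
        refine ⟨s' * s, ?_, ?_⟩
        · rw [RingHom.mem_ker, map_mul]
          rw [hev, Ne, map_eq_zero_iff _ hinj] at hs
          exact mul_ne_zero hs' hs
        · have h1 : s' * s * g = s' * (∑ j, a j * f j) + s' * (s * g - ∑ j, a j * f j) := by ring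
          rw [h1]
          exact Submodule.add_mem_sup (Ideal.mul_mem_left _ _ (Submodule.sum_mem _ fun j _ =>
            Ideal.mul_mem_left _ _ (Ideal.subset_span ⟨j, rfl⟩))) hmem) g hg
    have h1 := Ideal.mem_map_of_mem (algebraMap _ T) htg
    rw [Ideal.map_span, ← Set.range_comp, map_mul] at h1
    -- Primality of `Q` removes the factor `t`, which does not vanish at `b`.
    refine (hQp.mem_or_mem h1).resolve_left fun h2 => ht ?_
    exact (hw0 t).1 (hQw h2)
  have hker : RingHom.ker w = Q := by
    refine le_antisymm (fun z hz => ?_) hQw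
    obtain ⟨q, d, rfl⟩ := IsLocalization.exists_mk'_eq P.primeCompl z
    rw [RingHom.mem_ker] at hz
    have h1 : w (algebraMap _ T q) = 0 := by
      rw [← IsLocalization.mk'_spec T q d, map_mul, hz, zero_mul]
    have h2 := hIQ q ((hw0 q).1 h1)
    rw [← IsLocalization.mk'_spec' T q d] at h2
    exact (Ideal.unit_mul_mem_iff_mem _ (IsLocalization.map_units T d)).1 h2
  have hwsurj : Function.Surjective w := by
    intro z
    obtain ⟨y, d, rfl⟩ := IsLocalization.exists_mk'_eq p.primeCompl z
    obtain ⟨y, rfl⟩ := hφ y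
    obtain ⟨d', hd'⟩ := hφ d
    refine ⟨IsLocalization.mk' T y (⟨d', fun h => d.2 (hd' ▸ h)⟩ : P.primeCompl), ?_⟩
    rw [Localization.localRingHom_mk']
    congr 1
    exact Subtype.ext hd'
  have e := (Ideal.quotEquivOfEq hker.symm).trans (RingHom.quotientKerEquivOfSurjective hwsurj)
  exact IsRegularLocalRing.of_ringEquiv (R := T ⧸ Q) e

/-! ### Dilatations and their effect on gradients. -/

theorem exists_mul_mem_sq_of_mem_sq {S : Type*} [CommRing S] (P J : Ideal S) [P.IsPrime]
    (h : ∀ q ∈ P, ∃ s ∉ P, s * q ∈ J) : ∀ q ∈ P ^ 2, ∃ s ∉ P, s * q ∈ J ^ 2 := by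
  intro q hq
  rw [pow_two] at hq
  refine Submodule.mul_induction_on hq (fun u hu v hv => ?_) ?_
  · obtain ⟨s, hs, hsu⟩ := h u hu
    obtain ⟨t, ht, htv⟩ := h v hv
    refine ⟨s * t, (inferInstance : P.IsPrime).mul_notMem hs ht, ?_⟩
    rw [mul_mul_mul_comm, pow_two]
    exact Ideal.mul_mem_mul hsu htv
  · rintro u v ⟨s, hs, hsu⟩ ⟨t, ht, htv⟩
    refine ⟨s * t, (inferInstance : P.IsPrime).mul_notMem hs ht, ?_⟩
    have h1 : s * t * (u + v) = t * (s * u) + s * (t * v) := by ring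
    rw [h1]
    exact add_mem (Ideal.mul_mem_left _ _ hsu) (Ideal.mul_mem_left _ _ htv)

theorem evalGrad_X {R E ι : Type*} [CommRing R] [CommRing E] [Algebra R E] [DecidableEq ι]
    (b : ι → E) (i : ι) : evalGrad b (X i : MvPolynomial ι R) = Pi.single i 1 := by
  ext j
  rw [evalGrad_apply, pderiv_X, Pi.single_comm]
  by_cases h : j = i
  · subst h; simp
  · simp [Pi.single_eq_of_ne h]

theorem evalGrad_C {R E ι : Type*} [CommRing R] [CommRing E] [Algebra R E]
    (b : ι → E) (a : R) : evalGrad b (C a : MvPolynomial ι R) = 0 := by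
  ext j
  simp [evalGrad_apply]

theorem evalGrad_C_mul {R E ι : Type*} [CommRing R] [CommRing E] [Algebra R E]
    (b : ι → E) (a : R) (f : MvPolynomial ι R) :
    evalGrad b (C a * f) = algebraMap R E a • evalGrad b f := by
  rw [evalGrad_mul, evalGrad_C, smul_zero, add_zero, aeval_C]

section Dilatation

variable {A E ι κ : Type*} [CommRing A] [CommRing E] [Algebra A E]

theorem evalGrad_rename_inl (b : ι → E) (y : κ → E) (f : MvPolynomial ι A) :
    evalGrad (Sum.elim b y) (rename Sum.inl f) = Sum.elim (evalGrad b f) 0 := by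
  classical
  induction f using MvPolynomial.induction_on with
  | C a =>
    rw [rename_C, evalGrad_C, evalGrad_C]
    ext (i | j) <;> rfl
  | add p q hp hq =>
    rw [map_add, map_add, map_add, hp, hq]
    ext (i | j) <;> simp
  | mul_X p n hp =>
    rw [map_mul, rename_X, evalGrad_mul, evalGrad_mul, hp, evalGrad_X, evalGrad_X, aeval_rename,
      Sum.elim_comp_inl]
    ext (i | j)
    · simp [Pi.single_apply]
    · simp

/-- The algebra map from polynomials in `X i`, `Y j` to polynomials over the fraction field sending
`Y j` to `x⁻¹ * p j`. -/
noncomputable def dilatationHom (K : Type*) [Field K] [Algebra A K] (x : A)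
    (p : κ → MvPolynomial ι A) : MvPolynomial (ι ⊕ κ) A →ₐ[A] MvPolynomial ι K :=
  aeval (Sum.elim X fun j => C (algebraMap A K x)⁻¹ * map (algebraMap A K) (p j))

/-- The map on differentials induced by a dilatation, scaled by `ϖ`. -/
noncomputable def dilatationGrad [Fintype κ] (ϖ : E) (v : κ → ι → E) :
    (ι ⊕ κ → E) →ₗ[E] ι → E where
  toFun e := fun i => ϖ * e (Sum.inl i) + ∑ j, e (Sum.inr j) * v j i
  map_add' e e' := by
    ext i
    simp only [Pi.add_apply, mul_add, add_mul, Finset.sum_add_distrib]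
    ring
  map_smul' a e := by
    ext i
    simp only [Pi.smul_apply, smul_eq_mul, RingHom.id_apply, mul_add, Finset.mul_sum, mul_assoc,
      mul_left_comm ϖ a]

theorem dilatationHom_rename_inl (K : Type*) [Field K] [Algebra A K] (x : A)
    (p : κ → MvPolynomial ι A) (f : MvPolynomial ι A) :
    dilatationHom K x p (rename Sum.inl f) = map (algebraMap A K) f := by
  rw [dilatationHom, aeval_rename, Sum.elim_comp_inl]
  induction f using MvPolynomial.induction_on with
  | C a => simp [MvPolynomial.algebraMap_eq, IsScalarTower.algebraMap_apply A K (MvPolynomial ι K)]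
  | add p q hp hq => rw [map_add, map_add, hp, hq]
  | mul_X p n hp => rw [map_mul, map_mul, hp, aeval_X, map_X]

theorem dilatationHom_X_inr (K : Type*) [Field K] [Algebra A K] (x : A)
    (p : κ → MvPolynomial ι A) (j : κ) :
    dilatationHom K x p (X (Sum.inr j)) =
      C (algebraMap A K x)⁻¹ * map (algebraMap A K) (p j) := by
  simp [dilatationHom]

theorem exists_dilatationHom_eq_inv_mul (K : Type*) [Field K] [Algebra A K] [Fintype κ] (x : A)
    (hx : algebraMap A K x ≠ 0) (p : κ → MvPolynomial ι A) {u : MvPolynomial ι A}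
    (hu : u ∈ Ideal.span (Set.range p) ⊔ Ideal.span {C x}) :
    ∃ g, dilatationHom K x p g = C (algebraMap A K x)⁻¹ * map (algebraMap A K) u := by
  obtain ⟨q, hq, r, hr, rfl⟩ := Submodule.mem_sup.1 hu
  obtain ⟨a, rfl⟩ := (Submodule.mem_span_range_iff_exists_fun _).1 hq
  obtain ⟨c, rfl⟩ := Ideal.mem_span_singleton'.1 hr
  refine ⟨∑ j, rename Sum.inl (a j) * X (Sum.inr j) + rename Sum.inl c, ?_⟩
  simp only [map_add, map_sum, map_mul, dilatationHom_rename_inl, dilatationHom_X_inr, map_C,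
    smul_eq_mul, mul_add, Finset.mul_sum]
  congr 1
  · exact Finset.sum_congr rfl fun j _ => by ring
  · rw [mul_left_comm, ← C_mul, inv_mul_cancel₀ hx, C_1, mul_one]

theorem exists_dilatationHom_eq_inv_sq_mul (K : Type*) [Field K] [Algebra A K] [Fintype κ] (x : A)
    (hx : algebraMap A K x ≠ 0) (p : κ → MvPolynomial ι A) {u : MvPolynomial ι A}
    (hu : u ∈ (Ideal.span (Set.range p) ⊔ Ideal.span {C x}) ^ 2) :
    ∃ g, dilatationHom K x p g = C ((algebraMap A K x)⁻¹ ^ 2) * map (algebraMap A K) u := by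
  rw [pow_two] at hu
  refine Submodule.mul_induction_on hu (fun u hu v hv => ?_) ?_
  · obtain ⟨g, hg⟩ := exists_dilatationHom_eq_inv_mul K x hx p hu
    obtain ⟨g', hg'⟩ := exists_dilatationHom_eq_inv_mul K x hx p hv
    refine ⟨g * g', ?_⟩
    rw [map_mul, hg, hg', map_mul, C_pow]
    ring
  · rintro u v ⟨g, hg⟩ ⟨g', hg'⟩
    exact ⟨g + g', by rw [map_add, hg, hg', map_add, mul_add]⟩

section Eval

variable {K K' : Type*} [Field K] [Field K'] [Algebra A K] [Algebra E K'] [Algebra A K']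
  [Algebra K K'] [IsScalarTower A E K'] [IsScalarTower A K K']

theorem aeval_dilatationHom {x : A} (hx : algebraMap A K x ≠ 0) {b : ι → E} {y : κ → E}
    {p : κ → MvPolynomial ι A} (hp : ∀ j, aeval b (p j) = algebraMap A E x * y j)
    (g : MvPolynomial (ι ⊕ κ) A) :
    aeval (fun i => algebraMap E K' (b i)) (dilatationHom K x p g) =
      algebraMap E K' (aeval (Sum.elim b y) g) := by
  have hx' : algebraMap A K' x ≠ 0 := by
    rw [IsScalarTower.algebraMap_apply A K K']
    exact (map_ne_zero _).2 hx
  have h : ((aeval fun i => algebraMap E K' (b i) : MvPolynomial ι K →ₐ[K] K').restrictScalars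
      A).comp (dilatationHom K x p) =
      (IsScalarTower.toAlgHom A E K').comp (aeval (Sum.elim b y)) := by
    ext (i | j)
    · simp [dilatationHom]
    · have h1 : aeval (fun i => algebraMap E K' (b i)) (p j) = algebraMap A K' x *
          algebraMap E K' (y j) := by
        rw [IsScalarTower.algebraMap_apply A E K', ← map_mul, ← hp]
        exact aeval_algebraMap_apply K' b (p j)
      simp only [AlgHom.comp_apply, AlgHom.restrictScalars_apply, dilatationHom_X_inr, map_mul,
        aeval_map_algebraMap, h1, aeval_X, Sum.elim_inr, algHom_C, map_inv₀,
        ← IsScalarTower.algebraMap_apply A K K', IsScalarTower.coe_toAlgHom']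
      rw [inv_mul_cancel_left₀ hx']
  exact DFunLike.congr_fun h g

/-- Chain rule for `Y j = p j / x`; multiplying by `x` keeps the map on differentials defined over
`E`. -/
theorem dilatationGrad_evalGrad [Fintype κ] {x : A} (hx : algebraMap A K x ≠ 0) {b : ι → E} {y : κ → E}
    {p : κ → MvPolynomial ι A} (hp : ∀ j, aeval b (p j) = algebraMap A E x * y j)
    (g : MvPolynomial (ι ⊕ κ) A) (i : ι) :
    algebraMap E K' (dilatationGrad (algebraMap A E x) (fun j => evalGrad b (p j))
        (evalGrad (Sum.elim b y) g) i) =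
      algebraMap A K' x * evalGrad (fun i => algebraMap E K' (b i)) (dilatationHom K x p g) i := by
  classical
  have hx' : algebraMap A K' x ≠ 0 := by
    rw [IsScalarTower.algebraMap_apply A K K']
    exact (map_ne_zero _).2 hx
  induction g using MvPolynomial.induction_on with
  | C a =>
    have : dilatationHom K x p (C a) = C (algebraMap A K a) := by
      rw [← rename_C Sum.inl, dilatationHom_rename_inl, map_C]
    rw [this, evalGrad_C, evalGrad_C, map_zero]
    simp
  | add f g hf hg =>
    rw [map_add, map_add, map_add, map_add, Pi.add_apply, Pi.add_apply, map_add, hf, hg, mul_add]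
  | mul_X f n hf =>
    have hX : algebraMap E K' (dilatationGrad (algebraMap A E x) (fun j => evalGrad b (p j))
        (evalGrad (Sum.elim b y) (X n : MvPolynomial (ι ⊕ κ) A)) i) = algebraMap A K' x *
          evalGrad (fun i => algebraMap E K' (b i)) (dilatationHom K x p (X n)) i := by
      rw [evalGrad_X]
      rcases n with n | j
      · have h1 : dilatationHom K x p (X (Sum.inl n)) = X n := by simp [dilatationHom]
        rw [h1, evalGrad_X]
        by_cases h : i = n
        · subst h
          simp [dilatationGrad, ← IsScalarTower.algebraMap_apply]
        · simp [dilatationGrad, h]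
      · rw [dilatationHom_X_inr, evalGrad_C_mul, evalGrad_map, Pi.smul_apply, smul_eq_mul,
          evalGrad_algebraMap (E' := K') b, map_inv₀, ← IsScalarTower.algebraMap_apply A K K',
          mul_inv_cancel_left₀ hx']
        simp [dilatationGrad, Pi.single_apply]
    have hn : aeval (Sum.elim b y) (X n : MvPolynomial (ι ⊕ κ) A) = Sum.elim b y n := aeval_X _ _
    rw [map_mul (dilatationHom K x p), evalGrad_mul, evalGrad_mul, map_add, map_smul, map_smul, Pi.add_apply,
      Pi.add_apply, Pi.smul_apply, Pi.smul_apply, Pi.smul_apply, Pi.smul_apply, map_add, smul_eq_mul,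
      smul_eq_mul, smul_eq_mul, smul_eq_mul, map_mul, map_mul, hf, hX,
      aeval_dilatationHom hx hp, aeval_dilatationHom hx hp]
    ring

end Eval

end Dilatation

/-! ### Strict decrease of the torsion length under a dilatation. -/

/-- Generators of the center of a dilatation, chosen with independent gradients. -/
theorem exists_generators_comap_maximalIdeal {A A' ι : Type*} [CommRing A] [IsDomain A]
    [IsDiscreteValuationRing A] [CommRing A'] [IsLocalRing A'] [Algebra A A']
    [IsLocalHom (algebraMap A A')] [Finite ι]
    (hres : IsSeparableFieldExtension (ResidueField A) (ResidueField A')) {x : A}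
    (hx : maximalIdeal A = Ideal.span {x}) (b : ι → A') :
    ∃ (m : ℕ) (p : Fin m → MvPolynomial ι A), (∀ j, aeval b (p j) ∈ maximalIdeal A') ∧
      LinearIndependent (ResidueField A') (fun j => evalGrad (fun i => residue A' (b i)) (p j)) ∧
      ∀ q ∈ (maximalIdeal A').comap (aeval (R := A) b),
        ∃ s ∉ (maximalIdeal A').comap (aeval (R := A) b),
          s * q ∈ Ideal.span (Set.range p) ⊔ Ideal.span {C x} := by
  set P := (maximalIdeal A').comap (aeval (R := A) b) with hP
  have hPres : ∀ q, q ∈ P ↔ aeval (fun i => residue A' (b i)) q = 0 := fun q => by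
    rw [aeval_residue, residue_eq_zero_iff, hP, Ideal.mem_comap]
  have hPp : P.IsPrime := inferInstance
  obtain ⟨m, p, hp, hli, hspan⟩ := exists_linearIndependent_evalGrad
    (fun i => residue A' (b i)) P (fun q hq => (hPres q).1 hq)
  -- Modulo the `p j`, a multiple of `q` has zero residual gradient, so it lies locally in `P ^ 2 +
  -- (x)`; Nakayama absorbs `P ^ 2`.
  refine ⟨m, p, hp, hli, exists_mul_mem_of_forall_exists_mul_mem_sup_sq _ _ fun q hq => ?_⟩
  obtain ⟨s, hs, a, ha⟩ := hspan q hq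
  have hmem : s * q - ∑ j, a j * p j ∈ P :=
    sub_mem (Ideal.mul_mem_left _ _ hq) (sum_mem fun j _ => Ideal.mul_mem_left _ _ (hp j))
  obtain ⟨t, ht, htm⟩ := exists_mul_mem_sq_sup_of_evalGrad_mem_maximalIdeal hres b _ hmem (by
    intro i
    rw [← residue_eq_zero_iff, ← evalGrad_residue, ha, Pi.zero_apply])
  refine ⟨t * s, hPp.mul_notMem ht (fun h => hs ((hPres s).1 h)), ?_⟩
  have h1 : t * s * q = t * (∑ j, a j * p j) + t * (s * q - ∑ j, a j * p j) := by ring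
  rw [hx, Ideal.map_span, Set.image_singleton] at htm
  rw [h1]
  refine add_mem (Submodule.mem_sup_left (Submodule.mem_sup_left (Ideal.mul_mem_left _ _
    (Submodule.sum_mem _ fun j _ => Ideal.mul_mem_left _ _ (Ideal.subset_span ⟨j, rfl⟩))))) ?_
  refine (sup_le ?_ ?_ : P ^ 2 ⊔ Ideal.span {C x} ≤ _) htm
  · exact le_sup_right
  · exact le_sup_right.trans le_sup_left

attribute [local instance] MvPolynomial.algebraMvPolynomial in
theorem MvPolynomial.exists_eq_inv_mul_map {A K ι : Type*} [CommRing A] [IsDomain A] [Field K]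
    [Algebra A K] [IsFractionRing A K] (h : MvPolynomial ι K) :
    ∃ a : A, a ≠ 0 ∧ ∃ u : MvPolynomial ι A,
      h = C (algebraMap A K a)⁻¹ * map (algebraMap A K) u := by
  obtain ⟨⟨u, _, a, ha, rfl⟩, hm⟩ :=
    IsLocalization.surj ((nonZeroDivisors A).map (C (σ := ι))) h
  have hm' : h * map (algebraMap A K) (C a) = map (algebraMap A K) u := hm
  have ha0 : algebraMap A K a ≠ 0 :=
    (map_ne_zero_iff _ (IsFractionRing.injective A K)).2 (nonZeroDivisors.ne_zero ha)
  refine ⟨a, nonZeroDivisors.ne_zero ha, u, ?_⟩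
  rw [← hm', map_C, mul_left_comm, ← C_mul, inv_mul_cancel₀ ha0, C_1, mul_one]

/-- The new generators are `y j = p j (b) / x`, and `Ψ` is `x` times the induced map on
differentials. Dividing relations by `x` gives the old relations back; dividing `f₀` by `x ^ 2`
gives the new element `r₀`. -/
theorem exists_dilatation_length_lt {A A' K K' ι : Type*} [CommRing A] [IsDomain A]
    [IsDiscreteValuationRing A] [CommRing A'] [IsDomain A'] [IsDiscreteValuationRing A']
    [Algebra A A'] [FaithfulSMul A A'] [IsLocalHom (algebraMap A A')] [Field K] [Field K']
    [Algebra A K] [IsFractionRing A K] [Algebra A' K'] [IsFractionRing A' K'] [Algebra A K']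
    [Algebra K K'] [IsScalarTower A A' K'] [IsScalarTower A K K'] [Finite ι]
    (hres : IsSeparableFieldExtension (ResidueField A) (ResidueField A')) {x : A}
    (hx : maximalIdeal A = Ideal.span {x})
    (hx' : maximalIdeal A' = Ideal.span {algebraMap A A' x}) (b : ι → A')
    (f₀ : MvPolynomial ι A) (r₀ : ι → A') (hf₀ : aeval b f₀ = 0)
    (hfr : evalGrad b f₀ = algebraMap A A' x • r₀) (hr₀ : r₀ ∉ gradRelations A b) :
    ∃ (m : ℕ) (y : Fin m → A'),
      Module.length A' (Submodule.torsion A' ((ι ⊕ Fin m → A') ⧸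
        gradRelations A (Sum.elim b y))) <
      Module.length A' (Submodule.torsion A' ((ι → A') ⧸ gradRelations A b)) := by
  classical
  have hx0 : x ≠ 0 := by
    rintro rfl
    exact IsDiscreteValuationRing.not_a_field A (hx.trans (Ideal.span_singleton_eq_bot.2 rfl))
  have hinjA : Function.Injective (algebraMap A A') := FaithfulSMul.algebraMap_injective A A'
  have hinj : Function.Injective (algebraMap A' K') := IsFractionRing.injective A' K'
  have hxA' : algebraMap A A' x ≠ 0 := (map_ne_zero_iff _ hinjA).2 hx0
  have hxK : algebraMap A K x ≠ 0 := (map_ne_zero_iff _ (IsFractionRing.injective A K)).2 hx0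
  have hxK' : algebraMap A K' x ≠ 0 := by
    rw [IsScalarTower.algebraMap_apply A K K']
    exact (map_ne_zero _).2 hxK
  obtain ⟨m, p, hpm, hli, hgen⟩ := exists_generators_comap_maximalIdeal hres hx b
  have hdiv : ∀ z ∈ maximalIdeal A', ∃ y, z = algebraMap A A' x * y := fun z hz => by
    rw [hx', Ideal.mem_span_singleton] at hz
    exact hz
  choose y hy using fun j => hdiv _ (hpm j)
  set P := (maximalIdeal A').comap (aeval (R := A) b) with hP
  have hunit : ∀ s ∉ P, IsUnit (aeval b s) := fun s hs => by
    by_contra h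
    exact hs ((mem_maximalIdeal _).2 h)
  let Ψ := dilatationGrad (algebraMap A A' x) fun j => evalGrad b (p j)
  have hpull : ∀ (g : MvPolynomial (ι ⊕ Fin m) A) (u : MvPolynomial ι A) (c : K),
      dilatationHom K x p g = C c * map (algebraMap A K) u →
      algebraMap A' K' (aeval (Sum.elim b y) g) =
        algebraMap K K' c * algebraMap A' K' (aeval b u) ∧
      ∀ i, algebraMap A' K' (Ψ (evalGrad (Sum.elim b y) g) i) =
        algebraMap A K' x * (algebraMap K K' c * algebraMap A' K' (evalGrad b u i)) := by
    intro g u c h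
    refine ⟨?_, fun i => ?_⟩
    · rw [← aeval_dilatationHom hxK hy, h, map_mul, aeval_C, aeval_map_algebraMap]
      congr 1
      exact aeval_algebraMap_apply K' b u
    · rw [dilatationGrad_evalGrad hxK hy, h, evalGrad_C_mul, evalGrad_map, Pi.smul_apply,
        smul_eq_mul, evalGrad_algebraMap (E' := K') b]
  refine ⟨m, y, length_torsion_quotient_lt _ _ Ψ ?_ ?_ ?_ r₀ ?_ hr₀⟩
  -- Independence of the gradients of the `p j` makes the `Y`-components of `e` divisible by `x`, so
  -- `e` is a combination of gradients of `p j - x * Y j`.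
  · intro e he
    have he' : ∀ i, algebraMap A A' x * e (Sum.inl i) +
        ∑ j, e (Sum.inr j) * evalGrad b (p j) i = 0 := fun i => congrFun he i
    have hdvd : ∀ j, e (Sum.inr j) ∈ maximalIdeal A' := by
      intro j
      rw [← residue_eq_zero_iff]
      refine Fintype.linearIndependent_iff.1 hli (fun j => residue A' (e (Sum.inr j))) ?_ j
      ext i
      have h1 := congrArg (residue A') (he' i)
      have h2 : residue A' (algebraMap A A' x) = 0 := by
        rw [residue_eq_zero_iff, hx']
        exact Ideal.mem_span_singleton_self _
      rw [map_add, map_mul, h2, zero_mul, zero_add, map_sum, map_zero] at h1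
      simpa only [Finset.sum_apply, Pi.smul_apply, smul_eq_mul, evalGrad_residue, Pi.zero_apply,
        map_mul] using h1
    choose β hβ using fun j => hdiv _ (hdvd j)
    have hrel : ∀ j, aeval (Sum.elim b y)
        (rename Sum.inl (p j) - C x * X (Sum.inr j) : MvPolynomial (ι ⊕ Fin m) A) = 0 := by
      intro j
      rw [map_sub, aeval_rename, Sum.elim_comp_inl, map_mul, aeval_C, aeval_X, Sum.elim_inr, hy j,
        sub_self]
    have he2 : e = -∑ j, β j • evalGrad (Sum.elim b y)
        (rename Sum.inl (p j) - C x * X (Sum.inr j) : MvPolynomial (ι ⊕ Fin m) A) := by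
      simp only [map_sub, evalGrad_rename_inl, evalGrad_C_mul, evalGrad_X]
      ext (i | j)
      · have h1 := he' i
        simp only [hβ, mul_assoc, ← Finset.mul_sum, ← mul_add] at h1
        have h2 := (mul_eq_zero.1 h1).resolve_left hxA'
        simpa using eq_neg_of_add_eq_zero_left h2
      · simp [hβ, Pi.single_apply, mul_comm, Algebra.smul_def]
    rw [he2]
    exact neg_mem (sum_mem fun j _ => Submodule.smul_mem _ _
      (evalGrad_mem_gradRelations _ (hrel j)))
  · refine Submodule.span_le.2 ?_
    rintro _ ⟨f, hf, rfl⟩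
    have hf' : aeval b f = 0 := hf
    obtain ⟨s, hs, hsf⟩ := hgen f (by rw [hP, Ideal.mem_comap, hf']; exact zero_mem _)
    obtain ⟨g, hg⟩ := exists_dilatationHom_eq_inv_mul K x hxK p hsf
    obtain ⟨h1, h2⟩ := hpull g _ _ hg
    rw [map_mul, hf', mul_zero, map_zero, mul_zero, map_eq_zero_iff _ hinj] at h1
    rw [SetLike.mem_coe, ← Submodule.smul_mem_iff_of_isUnit _ (hunit s hs)]
    refine ⟨_, evalGrad_mem_gradRelations _ h1, ?_⟩
    ext i
    apply hinj
    rw [h2, evalGrad_mul_of_mem_ker b s hf', map_inv₀, ← IsScalarTower.algebraMap_apply A K K',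
      mul_inv_cancel_left₀ hxK']
  · intro r hr
    refine Submodule.span_induction ?_ ?_ ?_ ?_ hr
    · rintro _ ⟨g, hg, rfl⟩
      have hg' : aeval (Sum.elim b y) g = 0 := hg
      obtain ⟨a, ha, u, hu⟩ : ∃ a : A, a ≠ 0 ∧ ∃ u : MvPolynomial ι A,
          dilatationHom K x p g = C (algebraMap A K a)⁻¹ * map (algebraMap A K) u :=
        MvPolynomial.exists_eq_inv_mul_map _
      have haK : algebraMap A K' a ≠ 0 := by
        rw [IsScalarTower.algebraMap_apply A K K']
        exact (map_ne_zero _).2 ((map_ne_zero_iff _ (IsFractionRing.injective A K)).2 ha)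
      obtain ⟨h1, h2⟩ := hpull g u _ hu
      rw [map_inv₀, ← IsScalarTower.algebraMap_apply A K K'] at h1 h2
      have hu0 : aeval b u = 0 := by
        rw [hg', map_zero] at h1
        have := (mul_eq_zero.1 h1.symm).resolve_left (inv_ne_zero haK)
        rwa [map_eq_zero_iff _ hinj] at this
      refine ⟨algebraMap A A' a, (map_ne_zero_iff _ hinjA).2 ha, ?_⟩
      have h3 : algebraMap A A' a • Ψ (evalGrad (Sum.elim b y) g) =
          algebraMap A A' x • evalGrad b u := by
        ext i
        apply hinj
        rw [Pi.smul_apply, smul_eq_mul, map_mul, h2, Pi.smul_apply, smul_eq_mul, map_mul,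
          ← IsScalarTower.algebraMap_apply A A' K', ← IsScalarTower.algebraMap_apply A A' K']
        field_simp
      rw [h3]
      exact Submodule.smul_mem _ _ (evalGrad_mem_gradRelations _ hu0)
    · exact ⟨1, one_ne_zero, by simp⟩
    · rintro u v - - ⟨a, ha, hau⟩ ⟨c, hc, hcv⟩
      refine ⟨a * c, mul_ne_zero ha hc, ?_⟩
      rw [map_add, smul_add, mul_smul a c (Ψ v), mul_comm a c, mul_smul c a (Ψ u)]
      exact add_mem (Submodule.smul_mem _ _ hau) (Submodule.smul_mem _ _ hcv)
    · rintro c u - ⟨a, ha, hau⟩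
      refine ⟨a, ha, ?_⟩
      rw [map_smul, smul_comm]
      exact Submodule.smul_mem _ _ hau
  · have hm2 : ∀ q ∈ P ^ 2, ∃ z, aeval b q = algebraMap A A' x * (algebraMap A A' x * z) := by
      intro q hq
      have h1 : aeval b q ∈ maximalIdeal A' ^ 2 := by
        have h2 := Ideal.mem_map_of_mem (aeval (R := A) b) hq
        rw [Ideal.map_pow] at h2
        exact Ideal.pow_right_mono Ideal.map_comap_le 2 h2
      rw [hx', Ideal.span_singleton_pow, Ideal.mem_span_singleton] at h1
      obtain ⟨z, hz⟩ := h1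
      exact ⟨z, by rw [hz]; ring⟩
    obtain ⟨s, hs, hsf⟩ := exists_mul_mem_sq_sup_of_evalGrad_mem_maximalIdeal hres b f₀
      (by rw [hf₀]; exact zero_mem _) (fun i => by
        rw [hfr, hx', Ideal.mem_span_singleton]
        exact ⟨r₀ i, rfl⟩)
    rw [hx, Ideal.map_span, Set.image_singleton] at hsf
    -- Write `s * f₀ = q + a * x` with `q ∈ P ^ 2`. Evaluation at `b` gives `0`, and `q(b)` is
    -- divisible by `x ^ 2`, so `a ∈ P` and `a * x ∈ P ^ 2`.
    have hsf2 : s * f₀ ∈ P ^ 2 := by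
      obtain ⟨q, hq, c, hc, hqc⟩ := Submodule.mem_sup.1 hsf
      obtain ⟨a, rfl⟩ := Ideal.mem_span_singleton'.1 hc
      obtain ⟨z, hz⟩ := hm2 q hq
      have h1 := congrArg (aeval b) hqc
      rw [map_add, map_mul, map_mul, hf₀, mul_zero, aeval_C, hz, mul_comm (aeval b a), ← mul_add] at h1
      have h2 := (mul_eq_zero.1 h1).resolve_left hxA'
      have haP : a ∈ P := by
        rw [hP, Ideal.mem_comap, hx', Ideal.mem_span_singleton]
        exact ⟨-z, by linear_combination h2⟩
      have hxP : C x ∈ P := by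
        rw [hP, Ideal.mem_comap, aeval_C, hx']
        exact Ideal.mem_span_singleton_self _
      rw [← hqc]
      refine add_mem hq ?_
      rw [pow_two]
      exact Ideal.mul_mem_mul haP hxP
    obtain ⟨t, ht, htf⟩ := exists_mul_mem_sq_of_mem_sq P _ hgen _ hsf2
    rw [← mul_assoc] at htf
    -- The powers of `x` cancel: `x` from `Ψ`, `x⁻²` from the division and `x` from the gradient of
    -- `f₀` leave a unit times `r₀`.
    obtain ⟨g, hg⟩ := exists_dilatationHom_eq_inv_sq_mul K x hxK p htf
    obtain ⟨h1, h2⟩ := hpull g _ _ hg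
    have hts : IsUnit (aeval b (t * s)) :=
      hunit _ ((inferInstance : P.IsPrime).mul_notMem ht hs)
    rw [map_mul (aeval b), hf₀, mul_zero, map_zero, mul_zero, map_eq_zero_iff _ hinj] at h1
    rw [← Submodule.smul_mem_iff_of_isUnit _ hts]
    refine ⟨_, evalGrad_mem_gradRelations _ h1, ?_⟩
    ext i
    apply hinj
    rw [h2, ← mul_assoc, evalGrad_mul_of_mem_ker b _ hf₀, hfr, map_pow, map_inv₀,
      ← IsScalarTower.algebraMap_apply A K K']
    simp only [Pi.smul_apply, smul_eq_mul, map_mul, ← IsScalarTower.algebraMap_apply A A' K']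
    field_simp

/-! ### The desingularization theorem. -/

theorem theorem1
    {A A' : Type*} [CommRing A] [IsDomain A] [IsDiscreteValuationRing A]
    [CommRing A'] [IsDomain A'] [IsDiscreteValuationRing A']
    [Algebra A A'] [FaithfulSMul A A'] [IsLocalHom (algebraMap A A')]
    (hunram : (IsLocalRing.maximalIdeal A).map (algebraMap A A') = IsLocalRing.maximalIdeal A')
    {K K' : Type*} [Field K] [Field K'] [Algebra A K] [IsFractionRing A K]
    [Algebra A' K'] [IsFractionRing A' K'] [Algebra A K'] [Algebra K K']
    [IsScalarTower A A' K'] [IsScalarTower A K K']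
    (hfrac : IsSeparableFieldExtension K K')
    (hres : IsSeparableFieldExtension (IsLocalRing.ResidueField A) (IsLocalRing.ResidueField A'))
    (B : Subalgebra A A') (hB : B.FG) :
    ∃ C : Subalgebra A A', C.FG ∧ B ≤ C ∧
      IsRegularLocalRing
        (Localization.AtPrime ((IsLocalRing.maximalIdeal A').comap (algebraMap C A'))) := by
  obtain ⟨x, hx⟩ := (IsPrincipalIdealRing.principal (maximalIdeal A)).principal
  have hx' : maximalIdeal A' = Ideal.span {algebraMap A A' x} := by
    rw [← hunram, hx]
    exact (Ideal.map_span _ _).trans (by rw [Set.image_singleton])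
  -- The index type varies in the induction, since each dilatation enlarges the generating family.
  have key : ∀ (n : ℕ∞) (ι : Type) (_ : Finite ι) (b : ι → A'),
      Module.length A' (Submodule.torsion A' ((ι → A') ⧸ gradRelations A b)) = n →
      ∃ (c : Subalgebra A A'), c.FG ∧ (aeval (R := A) b).range ≤ c ∧
        IsRegularLocalRing (Localization.AtPrime ((maximalIdeal A').comap (algebraMap c A'))) := by
    intro n
    induction n using WellFoundedLT.induction with
    | _ n ih =>
    intro ι hι b hn
    rcases exists_gradRelations_dichotomy (A := A) _ hx' b with
      ⟨f, r, hf, hfr, hr⟩ | ⟨c, f, hf, hli, hspan⟩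
    · obtain ⟨m, y, hlt⟩ := exists_dilatation_length_lt (K := K) (K' := K') hres hx hx' b f r hf hfr hr
      obtain ⟨C, hCfg, hC, hreg⟩ := ih _ (hn ▸ hlt) (ι ⊕ Fin m) inferInstance (Sum.elim b y) rfl
      refine ⟨C, hCfg, le_trans ?_ hC, hreg⟩
      rintro _ ⟨q, rfl⟩
      refine ⟨rename Sum.inl q, ?_⟩
      change aeval _ (rename _ q) = aeval b q
      rw [aeval_rename, Sum.elim_comp_inl]
    · refine ⟨_, ?_, le_rfl,
        isRegularLocalRing_of_linearIndependent_evalGrad hfrac b f hf hli hspan⟩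
      rw [← Algebra.adjoin_range_eq_range_aeval]
      exact Subalgebra.fg_def.2 ⟨_, Set.finite_range b, rfl⟩
  obtain ⟨t, ht⟩ := hB
  obtain ⟨C, hCfg, hC, hreg⟩ := key _ (Fin t.card) inferInstance
    (fun i => (t.equivFin.symm i : A')) rfl
  refine ⟨C, hCfg, le_trans ?_ hC, hreg⟩
  rw [← ht, ← Algebra.adjoin_range_eq_range_aeval]
  refine Algebra.adjoin_mono fun z hz => ⟨t.equivFin ⟨z, hz⟩, ?_⟩
  simp
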